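/- Let $m\ge 1$ and $n\ge 0$ be integers. Let $G(m,1,n)$ be the group of $n\times n$ monomial matrices whose nonzero entries are $m$-th roots of unity. Encode an element by a pair $[u;g]$, $u\in S_n$, $g=(g_1,\dots,g_n)\in(\mathbb Z/m\mathbb Z)^n$: the nonzero entry of column $k$ is in row $u(k)$ and equals $\exp(2\pi i g_k/m)$. Thus $[u;g][v;b]=[uv;v(g)+b]$ with $v(g)_k=g_{v(k)}$. An $m$-colored partition $\overline\lambda=(\lambda_0,\dots,\lambda_{m-1})$ is a family of partitions indexed by $\mathbb Z/m\mathbb Z$; its size is $|\lambda_0|+\dots+|\lambda_{m-1}|$. The colored partition of $[u;g]$ is the one whose component $\lambda_\alpha$ consists of the lengths of those cycles $(i_1\,\dots\,i_k)$ of $u$ (fixed points included) with $g_{i_1}+\dots+g_{i_k}=\alpha$. Let $C_{\overline\lambda}\subset G(m,1,n)$ be the set of elements with colored partition $\overline\lambda$, and let $\mathcal C_{\overline\lambda}=\frac1{\#C_{\overline\lambda}}\sum_{x\in C_{\overline\lambda}}x$, an element of the center $Z[G(m,1,n)]$ of the group algebra $\mathbb C[G(m,1,n)]$. Let $\mathbb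 C[\mathbf p]$ be the polynomial ring in the variables $p^{(\alpha)}_i$, $\alpha\in\mathbb Z/m\mathbb Z$, $i\ge1$, graded by $\deg p^{(\alpha)}_i=i$, and let $\mathbb C[\mathbf p]_n$ be its homogeneous component of degree $n$. Put $p_{\overline\lambda}=\prod_{\alpha}\prod_{i}p^{(\alpha)}_{i}$, where $i$ runs over the parts of $\lambda_\alpha$ with multiplicity. Let $\mathcal T_0$ be the sum of all reflections in the set $\mathcal R$ of the elements $[(i\ j);g]$, $i\ne j$, with $g_i=\alpha$, $g_j=-\alpha$ and all other $g_k=0$ ($\alpha\in\mathbb Z/m\mathbb Z$). For $k\in\mathbb Z/m\mathbb Z$, $k\neq0$, let $\mathcal T_k$ be the sum of all reflections $[\mathrm{id};g]$ with $g_i=k$ for one index $i$ and $g_j=0$ for $j\ne i$. These sums are central; let $T_k$ be the operator of multiplication by $\mathcal T_k$ on $Z[G(m,1,n)]$, for all $k\in\mathbb Z/m\mathbb Z$. **Theorem.** There is a unique linear isomorphism $\Theta:Z[G(m,1,n)]\to\mathbb C[\mathbf p]_n$ with $\Theta(\mathcal C_{\overline\lambda})=p_{\overline\lambda}$ for all $m$-colored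 partitions $\overline\lambda$ of size $n$. The cut-and-join operators $\mathcal{CJ}_k=\Theta\circ T_k\circ\Theta^{-1}$ on $\mathbb C[\mathbf p]_n$ are the restrictions to $\mathbb C[\mathbf p]_n$ of the following differential operators: $$\mathcal{CJ}_0=\frac12\sum_{\substack{i,j\ge1\\ \alpha,\gamma\in\mathbb Z/m\mathbb Z}}\left[(i+j)\,p^{(\alpha)}_ip^{(\gamma)}_j\frac{\partial}{\partial p^{(\alpha+\gamma)}_{i+j}}+m\,ij\,p^{(\alpha+\gamma)}_{i+j}\frac{\partial^2}{\partial p^{(\alpha)}_i\partial p^{(\gamma)}_j}\right],$$ $$\mathcal{CJ}_k=\sum_{\substack{i\ge1\\ \alpha\in\mathbb Z/m\mathbb Z}}i\,p^{(\alpha+k)}_i\frac{\partial}{\partial p^{(\alpha)}_i}\qquad\text{for }k\in\mathbb Z/m\mathbb Z,\ k\ne0.$$ (Only finitely many terms of each sum are nonzero on a given polynomial.) -/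

import Mathlib

open MvPolynomial

/-- The complex reflection group `G(m,1,n)`, each monomial matrix being encoded by the pair `[u; g]`:
the nonzero entry of column `k` stands in row `u k` and equals `exp (2 π i g_k / m)`. -/
@[ext]
structure GroupGm1n (m n : ℕ) where
  /-- the permutation `u` -/
  perm : Equiv.Perm (Fin n)
  /-- the exponents `g = (g_1, …, g_n)` -/
  color : Fin n → ZMod m

namespace GroupGm1n

variable {m n : ℕ}

/-- The product `[u; g] [v; b] = [u v; v(g) + b]`, where `v(g)_k = g_{v(k)}`. -/
instance : Mul (GroupGm1n m n) :=
  ⟨fun x y => ⟨x.perm * y.perm, fun k => x.color (y.perm k) + y.color k⟩⟩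

instance : One (GroupGm1n m n) := ⟨⟨1, 0⟩⟩

instance : Inv (GroupGm1n m n) := ⟨fun x => ⟨x.perm⁻¹, fun k => -x.color (x.perm⁻¹ k)⟩⟩

@[simp] theorem mul_perm (x y : GroupGm1n m n) : (x * y).perm = x.perm * y.perm := rfl
@[simp] theorem mul_color (x y : GroupGm1n m n) (k : Fin n) :
    (x * y).color k = x.color (y.perm k) + y.color k := rfl
@[simp] theorem one_perm : (1 : GroupGm1n m n).perm = 1 := rfl
@[simp] theorem one_color (k : Fin n) : (1 : GroupGm1n m n).color k = 0 := rfl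
@[simp] theorem inv_perm (x : GroupGm1n m n) : (x⁻¹).perm = x.perm⁻¹ := rfl
@[simp] theorem inv_color (x : GroupGm1n m n) (k : Fin n) :
    (x⁻¹).color k = -x.color (x.perm⁻¹ k) := rfl

instance : Group (GroupGm1n m n) :=
  Group.ofLeftAxioms
    (fun x y z => by ext k <;> simp [mul_assoc, add_assoc])
    (fun x => by ext k <;> simp)
    (fun x => by ext k <;> simp)

/-- Elements of `G(m,1,n)` as pairs. -/
def equivProd : GroupGm1n m n ≃ Equiv.Perm (Fin n) × (Fin n → ZMod m) where
  toFun x := (x.perm, x.color)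
  invFun p := ⟨p.1, p.2⟩
  left_inv _ := rfl
  right_inv _ := rfl

noncomputable instance [NeZero m] : Fintype (GroupGm1n m n) := Fintype.ofEquiv _ equivProd.symm

noncomputable instance : DecidableEq (GroupGm1n m n) := Classical.decEq _

/-- The monomial matrix encoded by `[u; g]`. -/
noncomputable def toMatrix [NeZero m] (x : GroupGm1n m n) : Matrix (Fin n) (Fin n) ℂ :=
  Matrix.of fun a k => if a = x.perm k then ZMod.stdAddChar (x.color k) else 0

theorem toMatrix_mul [NeZero m] (x y : GroupGm1n m n) :
    (x * y).toMatrix = x.toMatrix * y.toMatrix := by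
  ext a k
  rw [Matrix.mul_apply, Finset.sum_eq_single (y.perm k)]
  · simp [toMatrix, AddChar.map_add_eq_mul]
  · intro b _ hb
    simp [toMatrix, hb]
  · simp

theorem toMatrix_injective [NeZero m] :
    Function.Injective (toMatrix : GroupGm1n m n → Matrix (Fin n) (Fin n) ℂ) := by
  intro x y h
  have key : ∀ k, x.perm k = y.perm k ∧ x.color k = y.color k := by
    intro k
    have hk := congrFun (congrFun h (x.perm k)) k
    have hne : (ZMod.stdAddChar (x.color k) : ℂ) ≠ 0 :=
      (AddChar.val_isUnit (ZMod.stdAddChar (N := m)) _).ne_zero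
    by_cases hp : x.perm k = y.perm k
    · refine ⟨hp, ZMod.injective_stdAddChar ?_⟩
      simpa [toMatrix, hp] using hk
    · simp [toMatrix, hp, hne] at hk
  ext k
  · exact congrArg Fin.val (key k).1
  · exact (key k).2

/-- The matrices encoded are precisely the monomial matrices (one nonzero entry in each row and in
each column) whose nonzero entries are `m`-th roots of unity. -/
theorem range_toMatrix [NeZero m] :
    Set.range (toMatrix : GroupGm1n m n → Matrix (Fin n) (Fin n) ℂ) =
      {M | (∀ k, ∃! a, M a k ≠ 0) ∧ (∀ a, ∃! k, M a k ≠ 0) ∧ ∀ a k, M a k ≠ 0 → M a k ^ m = 1} := by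
  ext M
  constructor
  · rintro ⟨x, rfl⟩
    have hne : ∀ c : ZMod m, (ZMod.stdAddChar c : ℂ) ≠ 0 := fun c =>
      (AddChar.val_isUnit (ZMod.stdAddChar (N := m)) _).ne_zero
    refine ⟨fun k => ⟨x.perm k, ?_, ?_⟩, fun a => ⟨x.perm⁻¹ a, ?_, ?_⟩, ?_⟩
    · simp [toMatrix, hne]
    · intro a ha
      by_contra h
      simp [toMatrix, h] at ha
    · simp [toMatrix, hne]
    · intro k hk
      by_contra h
      apply hk
      have : a ≠ x.perm k := by
        rintro rfl
        simp at h
      simp [toMatrix, this]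
    · intro a k h
      have : a = x.perm k := by
        by_contra h'
        simp [toMatrix, h'] at h
      subst this
      simp [toMatrix, ← AddChar.map_nsmul_eq_pow]
  · rintro ⟨h1, h2, h3⟩
    choose u hu hu' using h1
    have hinj : Function.Injective u := by
      intro a b hab
      exact (h2 (u a)).unique (hu a) (by rw [hab]; exact hu b)
    have hroot : ∀ k, ∃ c : ZMod m, (ZMod.stdAddChar c : ℂ) = M (u k) k := by
      intro k
      have hprim := Complex.isPrimitiveRoot_exp m (NeZero.ne m)
      obtain ⟨i, -, hi⟩ := hprim.eq_pow_of_pow_eq_one (h3 _ _ (hu k))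
      refine ⟨((i : ℤ) : ZMod m), ?_⟩
      rw [ZMod.stdAddChar_coe, ← hi, ← Complex.exp_nat_mul]
      congr 1
      push_cast
      ring
    choose c hc using hroot
    refine ⟨⟨Equiv.ofBijective u (Finite.injective_iff_bijective.mp hinj), c⟩, ?_⟩
    ext a k
    by_cases h : a = u k
    · subst h
      simp [toMatrix, hc]
    · have : M a k = 0 := by
        by_contra h'
        exact h (hu' k a h')
      simp [toMatrix, h, this]

/-- The reflection `r_{ij}^{(α)} = [(i j); 0, …, α, …, -α, …, 0]`, with `α` in position `i` and `-α`
in position `j` (meaningful for `i ≠ j`). It fixes the hyperplane `x_j = exp (2 π i / m) ^ α x_i`. -/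
def r (i j : Fin n) (α : ZMod m) : GroupGm1n m n :=
  ⟨Equiv.swap i j, Pi.single i α - Pi.single j α⟩

/-- The reflection `ℓ_i^α = [id; 0, …, α, …, 0]`, with `α` in position `i` (meaningful for `α ≠ 0`).
It fixes the hyperplane `x_i = 0`. -/
def l (i : Fin n) (α : ZMod m) : GroupGm1n m n :=
  ⟨1, Pi.single i α⟩

open Classical in
/-- The classes of reflections, indexed by `ℤ/m`: the class of index `0` is `𝓡`, the set of all
`r_{ij}^{(α)}`, and the class of index `k ≠ 0` is `𝓛^k`, the set of all `ℓ_i^k`. -/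
noncomputable def reflectionClass (m n : ℕ) [NeZero m] (k : ZMod m) : Finset (GroupGm1n m n) :=
  if k = 0 then Finset.univ.filter fun x => ∃ (i j : Fin n) (α : ZMod m), i ≠ j ∧ x = r i j α
  else Finset.univ.filter fun x => ∃ i : Fin n, x = l i k

open Classical in
/-- The supports of the cycles of the permutation `u` of `x = [u; g]`, fixed points included. -/
noncomputable def cycles (x : GroupGm1n m n) : Finset (Finset (Fin n)) :=
  Finset.univ.image fun i => Finset.univ.filter fun j => x.perm.SameCycle i j

end GroupGm1n

/-- An `m`-colored partition `λ₀ | … | λ_{m-1}`: a map from `ℤ/m` to partitions, a partition being a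
finite multiset of positive integers. -/
abbrev ColoredPartition (m : ℕ) : Type := ZMod m → Multiset ℕ+

/-- The total size `|λ₀| + … + |λ_{m-1}|`. -/
def ColoredPartition.size {m : ℕ} [NeZero m] (lam : ColoredPartition m) : ℕ :=
  ∑ r : ZMod m, ((lam r).map fun i : ℕ+ => (i : ℕ)).sum

namespace GroupGm1n

variable {m n : ℕ}

open Classical in
/-- The colored partition of `x = [u; g]`: its value at `r` consists of the lengths of the cycles
`(i₁ … i_k)` of `u` (fixed points included) with cycle product `g_{i₁} + ⋯ + g_{i_k} = r`. -/
noncomputable def coloredType (x : GroupGm1n m n) : ColoredPartition m := fun r =>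
  (x.cycles.filter fun c => ∑ i ∈ c, x.color i = r).val.map fun c => c.card.toPNat'

/-- The set `C_λ` of elements whose colored partition is `λ`. -/
noncomputable def conjClass (n : ℕ) [NeZero m] (lam : ColoredPartition m) :
    Finset (GroupGm1n m n) :=
  Finset.univ.filter fun x => x.coloredType = lam

open Classical in
theorem cycles_conj (y x : GroupGm1n m n) :
    (y * x * y⁻¹).cycles = x.cycles.image fun c => c.map y.perm.toEmbedding := by
  ext c
  simp only [cycles, Finset.mem_image, Finset.mem_univ, true_and, exists_exists_eq_and]
  have key : ∀ i : Fin n,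
      (Finset.univ.filter fun j => x.perm.SameCycle i j).map y.perm.toEmbedding =
        Finset.univ.filter fun j => (y * x * y⁻¹).perm.SameCycle (y.perm i) j := by
    intro i
    ext j
    simp only [Finset.mem_map_equiv, Finset.mem_filter, Finset.mem_univ, true_and, mul_perm,
      inv_perm, Equiv.Perm.sameCycle_conj]
    rw [show y.perm⁻¹ (y.perm i) = i from y.perm.symm_apply_apply i]
    rfl
  constructor
  · rintro ⟨i, rfl⟩
    refine ⟨y.perm⁻¹ i, ?_⟩
    rw [key]
    simp
  · rintro ⟨i, rfl⟩
    exact ⟨y.perm i, (key i).symm⟩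

theorem mem_cycles_map_perm {x : GroupGm1n m n} {c : Finset (Fin n)} (hc : c ∈ x.cycles) :
    c.map x.perm.toEmbedding = c := by
  classical
  simp only [cycles, Finset.mem_image, Finset.mem_univ, true_and] at hc
  obtain ⟨i, rfl⟩ := hc
  ext j
  simp only [Finset.mem_map_equiv, Finset.mem_filter, Finset.mem_univ, true_and]
  exact Equiv.Perm.sameCycle_symm_apply_right

theorem sum_color_conj (y x : GroupGm1n m n) {c : Finset (Fin n)} (hc : c ∈ x.cycles) :
    ∑ i ∈ c.map y.perm.toEmbedding, (y * x * y⁻¹).color i = ∑ i ∈ c, x.color i := by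
  have h : ∑ i ∈ c, y.color (x.perm i) = ∑ i ∈ c, y.color i := by
    conv_rhs => rw [← mem_cycles_map_perm hc, Finset.sum_map]
    rfl
  simp [Finset.sum_add_distrib, h]

theorem coloredType_conj (y x : GroupGm1n m n) :
    (y * x * y⁻¹).coloredType = x.coloredType := by
  classical
  funext r
  have hinj : Function.Injective fun c : Finset (Fin n) => c.map y.perm.toEmbedding :=
    Finset.map_injective _
  have h : ((y * x * y⁻¹).cycles.filter fun c => ∑ i ∈ c, (y * x * y⁻¹).color i = r) =
      (x.cycles.filter fun c => ∑ i ∈ c, x.color i = r).map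
        ⟨fun c => c.map y.perm.toEmbedding, hinj⟩ := by
    rw [Finset.map_eq_image, cycles_conj, Finset.filter_image]
    show Finset.image _ _ = Finset.image _ _
    congr 1
    refine Finset.filter_congr fun c hc => ?_
    rw [sum_color_conj y x hc]
  unfold coloredType
  rw [h, Finset.map_val, Multiset.map_map]
  simp

theorem conj_mem_reflectionClass [NeZero m] (k : ZMod m) (y x : GroupGm1n m n)
    (hx : x ∈ reflectionClass m n k) : y * x * y⁻¹ ∈ reflectionClass m n k := by
  classical
  unfold reflectionClass at hx ⊢
  split_ifs at hx ⊢ with hk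
  · simp only [Finset.mem_filter, Finset.mem_univ, true_and] at hx ⊢
    obtain ⟨i, j, α, hij, rfl⟩ := hx
    refine ⟨y.perm i, y.perm j, α + y.color j - y.color i, by simpa using hij, ?_⟩
    refine GroupGm1n.ext ?_ ?_
    · exact (Equiv.swap_apply_apply y.perm i j).symm
    · funext a
      obtain ⟨b, rfl⟩ := y.perm.surjective a
      by_cases hi : b = i
      · subst hi
        simp [r, hij]
        ring
      · by_cases hj : b = j
        · subst hj
          simp [r, hi]
          ring
        · simp [r, hi, hj, Equiv.swap_apply_of_ne_of_ne]
  · simp only [Finset.mem_filter, Finset.mem_univ, true_and] at hx ⊢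
    obtain ⟨i, rfl⟩ := hx
    refine ⟨y.perm i, ?_⟩
    refine GroupGm1n.ext ?_ ?_
    · simp [l]
    · funext a
      obtain ⟨b, rfl⟩ := y.perm.surjective a
      by_cases hi : b = i
      · subst hi
        simp [l]
      · simp [l, hi]

/-- The sum of the elements of a conjugation-invariant set is central in the group algebra. -/
theorem sum_mem_center (S : Finset (GroupGm1n m n)) (hS : ∀ y, ∀ x ∈ S, y * x * y⁻¹ ∈ S) :
    (∑ x ∈ S, MonoidAlgebra.of ℂ (GroupGm1n m n) x) ∈
      Subalgebra.center ℂ (MonoidAlgebra ℂ (GroupGm1n m n)) := by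
  rw [Subalgebra.mem_center_iff]
  intro b
  induction b using MonoidAlgebra.induction_on with
  | of y =>
    rw [Finset.mul_sum, Finset.sum_mul]
    refine Finset.sum_bij' (fun x _ => y * x * y⁻¹) (fun x _ => y⁻¹ * x * y) (fun x hx => hS y x hx)
      (fun x hx => by simpa using hS y⁻¹ x hx) ?_ ?_ ?_
    · intro x _
      group
    · intro x _
      group
    · intro x _
      rw [← map_mul, ← map_mul]
      simp
  | add f g hf hg => rw [add_mul, mul_add, hf, hg]
  | smul c f hf => rw [smul_mul_assoc, mul_smul_comm, hf]

end GroupGm1n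

/-- The center `Z[G(m,1,n)]` of the complex group algebra. -/
abbrev GroupCenter (m n : ℕ) : Type :=
  Subalgebra.center ℂ (MonoidAlgebra ℂ (GroupGm1n m n))

/-- The normalized class sum `𝓒_λ = (1 / #C_λ) ∑_{x ∈ C_λ} x`. -/
noncomputable def classAverage {m : ℕ} [NeZero m] (n : ℕ) (lam : ColoredPartition m) :
    GroupCenter m n :=
  ((GroupGm1n.conjClass n lam).card : ℂ)⁻¹ •
    ⟨∑ x ∈ GroupGm1n.conjClass n lam, MonoidAlgebra.of ℂ (GroupGm1n m n) x,
      GroupGm1n.sum_mem_center _ fun y x hx => by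
        simpa [GroupGm1n.conjClass, GroupGm1n.coloredType_conj] using hx⟩

/-- The sum `𝓣_k` of all reflections in the class of index `k`. -/
noncomputable def reflectionSum (m n : ℕ) [NeZero m] (k : ZMod m) : GroupCenter m n :=
  ⟨∑ x ∈ GroupGm1n.reflectionClass m n k, MonoidAlgebra.of ℂ (GroupGm1n m n) x,
    GroupGm1n.sum_mem_center _ (GroupGm1n.conj_mem_reflectionClass k)⟩

/-- The polynomial ring `ℂ[p]` in the variables `p_i^{(α)}`, `α ∈ ℤ/m`, `i ≥ 1`; the variable
`p_i^{(α)}` is `X (α, i)`. -/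
abbrev PowerSumRing (m : ℕ) : Type := MvPolynomial (ZMod m × ℕ+) ℂ

/-- The homogeneous component `ℂ[p]_n` of total degree `n`, where `deg p_i^{(α)} = i`. -/
abbrev PowerSumComponent (m n : ℕ) : Type :=
  weightedHomogeneousSubmodule ℂ (fun v : ZMod m × ℕ+ => (v.2 : ℕ)) n

/-- The monomial `p_λ = p_{λ₀}^{(0)} ⋯ p_{λ_{m-1}}^{(m-1)}`. -/
noncomputable def powerSumMonomial {m : ℕ} [NeZero m] (lam : ColoredPartition m) :
    PowerSumRing m :=
  ∏ α : ZMod m, ((lam α).map fun i => (X (α, i) : PowerSumRing m)).prod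

/-- `Θ : Z[G(m,1,n)] ≃ ℂ[p]_n` is the linear isomorphism with `Θ 𝓒_λ = p_λ` for every `m`-colored
partition `λ` of `n`. -/
def IsTheta {m n : ℕ} [NeZero m] (Θ : GroupCenter m n ≃ₗ[ℂ] PowerSumComponent m n) : Prop :=
  ∀ lam : ColoredPartition m, lam.size = n →
    (Θ (classAverage n lam) : PowerSumRing m) = powerSumMonomial lam

/-- The cut-and-join operator `𝓒𝓙_k = Θ ∘ T_k ∘ Θ⁻¹` on `ℂ[p]_n`, where `T_k` is the
multiplication by `𝓣_k` on `Z[G(m,1,n)]`. -/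
noncomputable def cutJoin {m n : ℕ} [NeZero m]
    (Θ : GroupCenter m n ≃ₗ[ℂ] PowerSumComponent m n) (k : ZMod m) :
    Module.End ℂ (PowerSumComponent m n) :=
  Θ.conj (LinearMap.mulLeft ℂ (reflectionSum m n k))

/-- The term of index `(i, j, α, γ)` of the differential operator for `𝓒𝓙_0`, applied to `f`:
`(i+j) p_i^{(α)} p_j^{(γ)} ∂f/∂p_{i+j}^{(α+γ)} + m i j p_{i+j}^{(α+γ)} ∂²f/∂p_i^{(α)}∂p_j^{(γ)}`. -/
noncomputable def cutJoinTerm {m : ℕ} (f : PowerSumRing m) (i j : ℕ+) (α γ : ZMod m) :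
    PowerSumRing m :=
  (((i : ℕ) + (j : ℕ) : ℕ) : ℂ) •
      (X (α, i) * X (γ, j) * pderiv (α + γ, i + j) f) +
    ((m * (i : ℕ) * (j : ℕ) : ℕ) : ℂ) •
      (X (α + γ, i + j) * pderiv (α, i) (pderiv (γ, j) f))

/-- Only finitely many terms are nonzero on a given polynomial. -/
theorem cutJoinTerm_finite {m : ℕ} [NeZero m] (f : PowerSumRing m) :
    (Function.support fun q : (ℕ+ × ℕ+) × ZMod m × ZMod m =>
      cutJoinTerm f q.1.1 q.1.2 q.2.1 q.2.2).Finite := by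
  classical
  obtain ⟨B, hB⟩ : ∃ B : ℕ+, ∀ v ∈ f.vars, v.2 ≤ B := by
    refine ⟨f.vars.sup Prod.snd, fun v hv => Finset.le_sup (f := Prod.snd) hv⟩
  refine (((Set.finite_Iic B).prod (Set.finite_Iic B)).prod
    (Set.finite_univ : (Set.univ : Set (ZMod m × ZMod m)).Finite)).subset ?_
  rintro ⟨⟨i, j⟩, α, γ⟩ h
  by_contra hcon
  apply h
  have hij : ¬ (i ≤ B ∧ j ≤ B) := fun hh => hcon ⟨⟨hh.1, hh.2⟩, Set.mem_univ _⟩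
  have hz : ∀ (β : ZMod m) (s : ℕ+), ¬ s ≤ B → pderiv (β, s) f = 0 := fun β s hs =>
    pderiv_eq_zero_of_notMem_vars fun hv => hs (hB _ hv)
  have h1 : pderiv (α + γ, i + j) f = 0 := by
    refine hz _ _ fun hs => hij ⟨?_, ?_⟩
    · exact (PNat.lt_add_right i j).le.trans hs
    · exact (PNat.lt_add_left j i).le.trans hs
  have h2 : pderiv (α, i) (pderiv (γ, j) f) = 0 := by
    by_cases hj : j ≤ B
    · have hc : ⁅(pderiv (α, i) : Derivation ℂ (PowerSumRing m) (PowerSumRing m)),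
          (pderiv (γ, j) : Derivation ℂ (PowerSumRing m) (PowerSumRing m))⁆ = 0 := by
        refine derivation_ext fun v => ?_
        simp only [Derivation.commutator_apply, pderiv_X, Derivation.coe_zero, Pi.zero_apply,
          Pi.single_apply]
        split_ifs <;> simp
      have hf := Derivation.congr_fun hc f
      rw [Derivation.commutator_apply, hz α i fun hi => hij ⟨hi, hj⟩, map_zero, sub_zero] at hf
      simpa using hf
    · rw [hz _ _ hj, map_zero]
  simp [cutJoinTerm, h1, h2]

/-- The differential operator
`½ ∑_{i,j ≥ 1; α,γ ∈ ℤ/m} [(i+j) p_i^{(α)} p_j^{(γ)} ∂/∂p_{i+j}^{(α+γ)}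
  + m i j p_{i+j}^{(α+γ)} ∂²/∂p_i^{(α)}∂p_j^{(γ)}]`. -/
noncomputable def cutJoinFormulaZero {m : ℕ} (f : PowerSumRing m) : PowerSumRing m :=
  (1 / 2 : ℂ) • ∑ᶠ q : (ℕ+ × ℕ+) × ZMod m × ZMod m, cutJoinTerm f q.1.1 q.1.2 q.2.1 q.2.2

/-- Only finitely many terms are nonzero on a given polynomial. -/
theorem eulerTerm_finite {m : ℕ} (k : ZMod m) (f : PowerSumRing m) :
    (Function.support fun q : ℕ+ × ZMod m =>
      (((q.1 : ℕ) : ℂ) • (X (q.2 + k, q.1) * pderiv (q.2, q.1) f) : PowerSumRing m)).Finite := by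
  classical
  refine (f.vars.image Prod.swap).finite_toSet.subset ?_
  rintro ⟨i, α⟩ h
  by_contra hcon
  apply h
  have : pderiv (α, i) f = 0 := by
    refine pderiv_eq_zero_of_notMem_vars fun hv => hcon ?_
    exact Finset.mem_coe.mpr (Finset.mem_image.mpr ⟨(α, i), hv, rfl⟩)
  simp [this]

/-- The differential operator `∑_{i ≥ 1; α ∈ ℤ/m} i p_i^{(α+k)} ∂/∂p_i^{(α)}`. -/
noncomputable def cutJoinFormula {m : ℕ} (k : ZMod m) (f : PowerSumRing m) : PowerSumRing m :=
  ∑ᶠ q : ℕ+ × ZMod m, ((q.1 : ℕ) : ℂ) • (X (q.2 + k, q.1) * pderiv (q.2, q.1) f)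

namespace Equiv.Perm

variable {ι : Type*} [Fintype ι] [DecidableEq ι]

open Classical in
/-- The support of the cycle of `u` through `i`; it is `{i}` if `i` is a fixed point. -/
noncomputable def cycleFinset (u : Perm ι) (i : ι) : Finset ι :=
  Finset.univ.filter fun j => u.SameCycle i j

/-- The first `a` elements `i, u i, …, u ^ (a - 1) i` of the orbit of `i`. -/
def arc (u : Perm ι) (i : ι) (a : ℕ) : Finset ι :=
  (Finset.range a).image fun s => (u ^ s) i

theorem mem_cycleFinset {u : Perm ι} {i j : ι} : j ∈ u.cycleFinset i ↔ u.SameCycle i j := by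
  simp [cycleFinset]

theorem self_mem_cycleFinset (u : Perm ι) (i : ι) : i ∈ u.cycleFinset i :=
  mem_cycleFinset.2 (SameCycle.refl _ _)

theorem cycleFinset_eq_iff {u : Perm ι} {i j : ι} :
    u.cycleFinset i = u.cycleFinset j ↔ u.SameCycle i j := by
  constructor
  · intro h
    exact mem_cycleFinset.1 (h ▸ self_mem_cycleFinset u j)
  · intro h
    ext k
    rw [mem_cycleFinset, mem_cycleFinset]
    exact ⟨fun hk => h.symm.trans hk, fun hk => h.trans hk⟩

theorem cycleFinset_eq_of_mem {u : Perm ι} {i j : ι} (h : j ∈ u.cycleFinset i) :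
    u.cycleFinset j = u.cycleFinset i :=
  (cycleFinset_eq_iff.2 (mem_cycleFinset.1 h)).symm

theorem card_cycleFinset_pos (u : Perm ι) (i : ι) : 0 < (u.cycleFinset i).card :=
  Finset.card_pos.2 ⟨i, self_mem_cycleFinset u i⟩

omit [Fintype ι] in
theorem mem_arc {u : Perm ι} {i j : ι} {a : ℕ} : j ∈ u.arc i a ↔ ∃ s < a, (u ^ s) i = j := by
  simp [arc]

omit [Fintype ι] in
theorem arc_add (u : Perm ι) (i : ι) (a b : ℕ) :
    u.arc i (a + b) = u.arc i a ∪ u.arc ((u ^ a) i) b := by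
  ext k
  simp only [Finset.mem_union, mem_arc]
  constructor
  · rintro ⟨s, hs, rfl⟩
    by_cases h : s < a
    · exact Or.inl ⟨s, h, rfl⟩
    · refine Or.inr ⟨s - a, by omega, ?_⟩
      rw [← mul_apply, ← pow_add, Nat.sub_add_cancel (by omega)]
  · rintro (⟨s, hs, rfl⟩ | ⟨s, hs, rfl⟩)
    · exact ⟨s, by omega, rfl⟩
    · exact ⟨s + a, by omega, by rw [pow_add, mul_apply]⟩

omit [Fintype ι] in
theorem arc_congr {u v : Perm ι} {i : ι} {a : ℕ} (h : ∀ s < a, (u ^ s) i = (v ^ s) i) :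
    u.arc i a = v.arc i a :=
  Finset.image_congr fun s hs => h s (by simpa using hs)

theorem cycleFinset_eq_arc_of_pow_apply_eq {u : Perm ι} {i : ι} {a : ℕ} (ha : 0 < a)
    (h : (u ^ a) i = i) : u.cycleFinset i = u.arc i a := by
  ext k
  rw [mem_cycleFinset, mem_arc]
  constructor
  · intro hk
    obtain ⟨s, rfl⟩ := hk.exists_nat_pow_eq
    refine ⟨s % a, Nat.mod_lt _ ha, ?_⟩
    have hp : Function.IsPeriodicPt u a i := by
      rw [Function.IsPeriodicPt, Function.IsFixedPt, iterate_eq_pow, h]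
    have := hp.iterate_mod_apply s
    simpa [iterate_eq_pow] using this
  · rintro ⟨s, -, rfl⟩
    exact ⟨s, by simp⟩

theorem exists_card_cycleFinset (u : Perm ι) (i : ι) :
    (u ^ (u.cycleFinset i).card) i = i ∧
      Set.InjOn (fun s : ℕ => (u ^ s) i) (Set.Iio (u.cycleFinset i).card) := by
  have hpos : 0 < Function.minimalPeriod u i :=
    Function.minimalPeriod_pos_of_mem_periodicPts (u.injective.mem_periodicPts i)
  have hinj : Set.InjOn (fun s : ℕ => (u ^ s) i) (Set.Iio (Function.minimalPeriod u i)) := by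
    simpa [iterate_eq_pow] using Function.iterate_injOn_Iio_minimalPeriod (f := u) (x := i)
  have hper : (u ^ Function.minimalPeriod u i) i = i := by
    have h := Function.iterate_minimalPeriod (f := u) (x := i)
    rwa [iterate_eq_pow] at h
  have hcard : (u.cycleFinset i).card = Function.minimalPeriod u i := by
    rw [cycleFinset_eq_arc_of_pow_apply_eq hpos hper, arc, Finset.card_image_of_injOn,
      Finset.card_range]
    simpa using hinj
  rw [hcard]
  exact ⟨hper, hinj⟩

theorem pow_card_cycleFinset_apply (u : Perm ι) (i : ι) :
    (u ^ (u.cycleFinset i).card) i = i :=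
  (exists_card_cycleFinset u i).1

theorem pow_apply_injOn (u : Perm ι) (i : ι) :
    Set.InjOn (fun s : ℕ => (u ^ s) i) (Set.Iio (u.cycleFinset i).card) :=
  (exists_card_cycleFinset u i).2

theorem cycleFinset_eq_arc (u : Perm ι) (i : ι) :
    u.cycleFinset i = u.arc i (u.cycleFinset i).card :=
  cycleFinset_eq_arc_of_pow_apply_eq (card_cycleFinset_pos u i) (pow_card_cycleFinset_apply u i)

theorem card_arc {u : Perm ι} {i : ι} {a : ℕ} (ha : a ≤ (u.cycleFinset i).card) :
    (u.arc i a).card = a := by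
  rw [arc, Finset.card_image_of_injOn, Finset.card_range]
  refine (pow_apply_injOn u i).mono fun s hs => ?_
  simp only [Finset.coe_range, Set.mem_Iio] at hs ⊢
  omega

theorem pow_apply_ne_self {u : Perm ι} {i : ι} {s : ℕ} (h0 : 0 < s)
    (hs : s < (u.cycleFinset i).card) : (u ^ s) i ≠ i := fun h =>
  h0.ne' (pow_apply_injOn u i (Set.mem_Iio.2 hs) (Set.mem_Iio.2 (by omega)) (by simpa using h))

theorem pow_apply_mem_cycleFinset (u : Perm ι) (i : ι) (s : ℕ) :
    (u ^ s) i ∈ u.cycleFinset i :=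
  mem_cycleFinset.2 ⟨s, by simp⟩

omit [Fintype ι] in
theorem swap_mul_pow_apply {u : Perm ι} {i j k : ι} {a : ℕ}
    (h : ∀ s, 0 < s → s < a → (u ^ s) k ≠ i ∧ (u ^ s) k ≠ j) :
    ∀ s < a, ((swap i j * u) ^ s) k = (u ^ s) k := by
  intro s
  induction s with
  | zero => simp
  | succ s ih =>
    intro hs
    obtain ⟨h1, h2⟩ := h (s + 1) (by omega) hs
    rw [pow_succ' (swap i j * u), mul_apply, ih (by omega), mul_apply, ← mul_apply u, ← pow_succ',
      swap_apply_of_ne_of_ne h1 h2]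

omit [Fintype ι] in
theorem swap_mul_pow_apply_last {u : Perm ι} {i j k : ι} {a : ℕ} (ha : 0 < a)
    (h : ∀ s, 0 < s → s < a → (u ^ s) k ≠ i ∧ (u ^ s) k ≠ j) :
    ((swap i j * u) ^ a) k = swap i j ((u ^ a) k) := by
  obtain ⟨b, rfl⟩ := Nat.exists_eq_succ_of_ne_zero ha.ne'
  rw [Nat.succ_eq_add_one, pow_succ' (swap i j * u), mul_apply,
    swap_mul_pow_apply h b (Nat.lt_succ_self b), mul_apply, ← mul_apply u, ← pow_succ']

theorem cycleFinset_swap_mul_of_notMem {u : Perm ι} {i j k : ι} (hi : i ∉ u.cycleFinset k)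
    (hj : j ∉ u.cycleFinset k) : (swap i j * u).cycleFinset k = u.cycleFinset k := by
  have hne : ∀ s : ℕ, (u ^ s) k ≠ i ∧ (u ^ s) k ≠ j := fun s =>
    ⟨fun h => hi (h ▸ pow_apply_mem_cycleFinset u k s),
      fun h => hj (h ▸ pow_apply_mem_cycleFinset u k s)⟩
  have hpos := card_cycleFinset_pos u k
  rw [cycleFinset_eq_arc u k, ← arc_congr (swap_mul_pow_apply fun s _ _ => hne s)]
  refine cycleFinset_eq_arc_of_pow_apply_eq hpos ?_
  rw [swap_mul_pow_apply_last hpos fun s _ _ => hne s, pow_card_cycleFinset_apply]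
  exact swap_apply_of_ne_of_ne (hne 0).1 (hne 0).2

/-- Multiplication by a transposition joins the cycles through the two points. -/
theorem cycleFinset_swap_mul_join {u : Perm ι} {i j : ι} (hij : ¬ u.SameCycle i j) :
    (swap i j * u).cycleFinset i = u.cycleFinset i ∪ u.cycleFinset j := by
  have hi : ∀ s, 0 < s → s < (u.cycleFinset i).card → (u ^ s) i ≠ i ∧ (u ^ s) i ≠ j :=
    fun s h0 hs => ⟨pow_apply_ne_self h0 hs, fun h => hij ⟨s, by simpa using h⟩⟩
  have hj : ∀ s, 0 < s → s < (u.cycleFinset j).card → (u ^ s) j ≠ i ∧ (u ^ s) j ≠ j :=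
    fun s h0 hs => ⟨fun h => hij (SameCycle.symm ⟨s, by simpa using h⟩), pow_apply_ne_self h0 hs⟩
  have hpi := card_cycleFinset_pos u i
  have hpj := card_cycleFinset_pos u j
  have hi' := swap_mul_pow_apply_last hpi hi
  have hj' := swap_mul_pow_apply_last hpj hj
  rw [pow_card_cycleFinset_apply, swap_apply_left] at hi'
  rw [pow_card_cycleFinset_apply, swap_apply_right] at hj'
  rw [cycleFinset_eq_arc_of_pow_apply_eq
      (a := (u.cycleFinset i).card + (u.cycleFinset j).card) (by omega)
      (by rw [add_comm, pow_add, mul_apply, hi', hj']),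
    arc_add, hi', arc_congr (swap_mul_pow_apply hi), arc_congr (swap_mul_pow_apply hj),
    ← cycleFinset_eq_arc, ← cycleFinset_eq_arc]

/-- Multiplication by a transposition cuts the cycle containing the two points. -/
theorem cycleFinset_swap_mul_cut {u : Perm ι} {i : ι} {a : ℕ} (ha : 0 < a)
    (haL : a < (u.cycleFinset i).card) :
    (swap i ((u ^ a) i) * u).cycleFinset i = u.arc i a := by
  have h : ∀ s, 0 < s → s < a → (u ^ s) i ≠ i ∧ (u ^ s) i ≠ (u ^ a) i := fun s h0 hs =>
    ⟨pow_apply_ne_self h0 (hs.trans haL), fun h =>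
      hs.ne (pow_apply_injOn u i (Set.mem_Iio.2 (hs.trans haL)) (Set.mem_Iio.2 haL) h)⟩
  rw [← arc_congr (swap_mul_pow_apply h)]
  refine cycleFinset_eq_arc_of_pow_apply_eq ha ?_
  rw [swap_mul_pow_apply_last ha h, swap_apply_right]

theorem cycleFinset_swap_mul_cut' {u : Perm ι} {i : ι} {a : ℕ} (ha : 0 < a)
    (haL : a < (u.cycleFinset i).card) :
    (swap i ((u ^ a) i) * u).cycleFinset ((u ^ a) i) =
      u.arc ((u ^ a) i) ((u.cycleFinset i).card - a) := by
  have hc := cycleFinset_eq_of_mem (pow_apply_mem_cycleFinset u i a)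
  have hi : (u ^ ((u.cycleFinset i).card - a)) ((u ^ a) i) = i := by
    rw [← mul_apply, ← pow_add, Nat.sub_add_cancel haL.le, pow_card_cycleFinset_apply]
  have h := cycleFinset_swap_mul_cut (u := u) (i := (u ^ a) i)
    (a := (u.cycleFinset i).card - a) (by omega) (by rw [hc]; omega)
  rwa [hi, swap_comm] at h

end Equiv.Perm

namespace GroupGm1n

variable {m n : ℕ}

theorem cycles_eq_image (x : GroupGm1n m n) :
    x.cycles = Finset.univ.image x.perm.cycleFinset := by
  classical
  unfold cycles Equiv.Perm.cycleFinset
  congr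

theorem mem_cycles {x : GroupGm1n m n} {c : Finset (Fin n)} :
    c ∈ x.cycles ↔ ∃ i, x.perm.cycleFinset i = c := by
  simp [cycles_eq_image]

theorem cycleFinset_mem_cycles (x : GroupGm1n m n) (i : Fin n) :
    x.perm.cycleFinset i ∈ x.cycles :=
  mem_cycles.2 ⟨i, rfl⟩

theorem cycleFinset_eq_of_mem_cycles {x : GroupGm1n m n} {c : Finset (Fin n)} (hc : c ∈ x.cycles)
    {i : Fin n} (hi : i ∈ c) : x.perm.cycleFinset i = c := by
  obtain ⟨j, rfl⟩ := mem_cycles.1 hc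
  exact Equiv.Perm.cycleFinset_eq_of_mem hi

theorem card_pos_of_mem_cycles {x : GroupGm1n m n} {c : Finset (Fin n)} (hc : c ∈ x.cycles) :
    0 < c.card := by
  obtain ⟨j, rfl⟩ := mem_cycles.1 hc
  exact Equiv.Perm.card_cycleFinset_pos _ _

theorem cycles_congr {x y : GroupGm1n m n} (h : x.perm = y.perm) : x.cycles = y.cycles := by
  rw [cycles_eq_image, cycles_eq_image, h]

theorem sum_eq_sum_cycles {M : Type*} [AddCommMonoid M] (x : GroupGm1n m n) (f : Fin n → M) :
    ∑ i, f i = ∑ c ∈ x.cycles, ∑ i ∈ c, f i := by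
  classical
  rw [← Finset.sum_fiberwise_of_maps_to (s := Finset.univ) (t := x.cycles)
    (g := x.perm.cycleFinset) fun i _ => cycleFinset_mem_cycles x i]
  refine Finset.sum_congr rfl fun c hc => Finset.sum_congr ?_ fun _ _ => rfl
  ext i
  simp only [Finset.mem_filter, Finset.mem_univ, true_and]
  exact ⟨fun h => h ▸ Equiv.Perm.self_mem_cycleFinset _ _, cycleFinset_eq_of_mem_cycles hc⟩

/-- The product of the colors along a cycle, written additively. -/
def colorSum (x : GroupGm1n m n) (c : Finset (Fin n)) : ZMod m := ∑ i ∈ c, x.color i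

/-- The cycle product and the length of a cycle. -/
def cycleIndex (x : GroupGm1n m n) (c : Finset (Fin n)) : ZMod m × ℕ+ :=
  (x.colorSum c, c.card.toPNat')

theorem r_mul_perm (i j : Fin n) (α : ZMod m) (x : GroupGm1n m n) :
    (r i j α * x).perm = Equiv.swap i j * x.perm := rfl

theorem l_mul_perm (i : Fin n) (α : ZMod m) (x : GroupGm1n m n) :
    (l i α * x).perm = x.perm := by
  simp [l]

theorem sum_comp_perm {M : Type*} [AddCommMonoid M] {x : GroupGm1n m n} {c : Finset (Fin n)}
    (hc : c ∈ x.cycles) (f : Fin n → M) : ∑ k ∈ c, f (x.perm k) = ∑ k ∈ c, f k := by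
  conv_rhs => rw [← mem_cycles_map_perm hc, Finset.sum_map]
  rfl

open Classical in
theorem colorSum_l_mul (i : Fin n) (α : ZMod m) (x : GroupGm1n m n) {c : Finset (Fin n)}
    (hc : c ∈ x.cycles) : (l i α * x).colorSum c = x.colorSum c + if i ∈ c then α else 0 := by
  simp only [colorSum, mul_color, Finset.sum_add_distrib]
  rw [sum_comp_perm hc (l i α).color, add_comm]
  simp [l, Pi.single_apply]

open Classical in
theorem colorSum_r_mul (i j : Fin n) (α : ZMod m) (x : GroupGm1n m n) {d : Finset (Fin n)}
    (hd : d ∈ (r i j α * x).cycles) :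
    (r i j α * x).colorSum d =
      x.colorSum d + ((if j ∈ d then α else 0) - if i ∈ d then α else 0) := by
  have h : ∀ k, (r i j α).color (x.perm k) =
      (r i j α).color (Equiv.swap i j ((r i j α * x).perm k)) := by
    intro k
    simp [r]
  simp only [colorSum, mul_color, Finset.sum_add_distrib, h]
  rw [sum_comp_perm hd fun k => (r i j α).color (Equiv.swap i j k), add_comm]
  congr 1
  simp only [r, Pi.sub_apply, Finset.sum_sub_distrib, Pi.single_apply,
    Equiv.swap_apply_eq_iff, Equiv.swap_apply_left, Equiv.swap_apply_right]
  simp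

end GroupGm1n

namespace GroupGm1n

variable {m n : ℕ}

theorem pow_perm (x : GroupGm1n m n) (e : ℕ) : (x ^ e).perm = x.perm ^ e := by
  induction e with
  | zero => rfl
  | succ e ih => rw [pow_succ, mul_perm, ih, pow_succ]

theorem pow_color (x : GroupGm1n m n) (e : ℕ) (i : Fin n) :
    (x ^ e).color i = ∑ s ∈ Finset.range e, x.color ((x.perm ^ s) i) := by
  induction e with
  | zero => rfl
  | succ e ih => rw [pow_succ', mul_color, ih, Finset.sum_range_succ, add_comm, pow_perm]

theorem pow_card_color (x : GroupGm1n m n) (i : Fin n) :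
    (x ^ (x.perm.cycleFinset i).card).color i = x.colorSum (x.perm.cycleFinset i) := by
  rw [pow_color, colorSum]
  conv_rhs => rw [Equiv.Perm.cycleFinset_eq_arc, Equiv.Perm.arc]
  rw [Finset.sum_image]
  intro s hs t ht hst
  exact Equiv.Perm.pow_apply_injOn x.perm i (by simpa using hs) (by simpa using ht) hst

theorem pow_mul_card (x : GroupGm1n m n) (i : Fin n) (q : ℕ) :
    (x ^ ((x.perm.cycleFinset i).card * q)).perm i = i ∧
      (x ^ ((x.perm.cycleFinset i).card * q)).color i = q • x.colorSum (x.perm.cycleFinset i) := by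
  induction q with
  | zero => simp
  | succ q ih =>
    have h : (x ^ (x.perm.cycleFinset i).card).perm i = i := by
      rw [pow_perm, Equiv.Perm.pow_card_cycleFinset_apply]
    rw [mul_add, mul_one, pow_add, mul_perm, mul_color, Equiv.Perm.mul_apply, h, ih.1, ih.2,
      pow_card_color, succ_nsmul]
    exact ⟨rfl, rfl⟩

/-- The action of the powers on the orbit of a point depends only on the exponent modulo the length
of the cycle, up to the cycle product. -/
theorem pow_eq_pow_mod (x : GroupGm1n m n) (i : Fin n) {L : ℕ} {α : ZMod m}
    (hL : (x.perm.cycleFinset i).card = L) (hα : x.colorSum (x.perm.cycleFinset i) = α) (e : ℕ) :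
    (x.perm ^ e) i = (x.perm ^ (e % L)) i ∧
      (x ^ e).color i = (x ^ (e % L)).color i + (e / L) • α := by
  subst hL hα
  obtain ⟨h1, h2⟩ := pow_mul_card x i (e / (x.perm.cycleFinset i).card)
  have he : x ^ e = x ^ (e % (x.perm.cycleFinset i).card) *
      x ^ ((x.perm.cycleFinset i).card * (e / (x.perm.cycleFinset i).card)) := by
    rw [← pow_add, Nat.mod_add_div]
  rw [← pow_perm, ← pow_perm]
  conv_lhs => rw [he]
  conv in (x ^ e).color i => rw [he]
  rw [mul_perm, mul_color, Equiv.Perm.mul_apply, h1, h2]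
  exact ⟨rfl, rfl⟩

theorem pow_apply_eq_iff_mod (x : GroupGm1n m n) (i : Fin n) {L : ℕ}
    (hL : (x.perm.cycleFinset i).card = L) (e f : ℕ) :
    (x.perm ^ e) i = (x.perm ^ f) i ↔ e % L = f % L := by
  have hpos : 0 < L := hL ▸ Equiv.Perm.card_cycleFinset_pos _ _
  rw [(pow_eq_pow_mod x i hL rfl e).1, (pow_eq_pow_mod x i hL rfl f).1]
  refine ⟨fun h => ?_, fun h => by rw [h]⟩
  subst hL
  exact Equiv.Perm.pow_apply_injOn x.perm i (Set.mem_Iio.2 (Nat.mod_lt _ hpos))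
    (Set.mem_Iio.2 (Nat.mod_lt _ hpos)) h

open Classical in
theorem count_coloredType (x : GroupGm1n m n) (v : ZMod m × ℕ+) :
    (x.coloredType v.1).count v.2 = (x.cycles.filter fun c => x.cycleIndex c = v).card := by
  rw [coloredType, Multiset.count_map, ← Finset.filter_val, Finset.filter_filter,
    ← Finset.card_def]
  congr 1
  ext c
  simp [cycleIndex, colorSum, Prod.ext_iff, eq_comm]

theorem exists_cycles_equiv {x x' : GroupGm1n m n} (h : x.coloredType = x'.coloredType) :
    ∃ φ : x.cycles ≃ x'.cycles, ∀ c, (φ c : Finset (Fin n)).card = (c : Finset (Fin n)).card ∧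
      x'.colorSum (φ c) = x.colorSum c := by
  classical
  have key : ∀ v : ZMod m × ℕ+, Nonempty
      ({c : x.cycles // x.cycleIndex c = v} ≃ {c : x'.cycles // x'.cycleIndex c = v}) := by
    intro v
    have hcount : ∀ y : GroupGm1n m n, Fintype.card {c : y.cycles // y.cycleIndex c = v} =
        (y.coloredType v.1).count v.2 := by
      intro y
      rw [count_coloredType, Fintype.card_subtype,
        ← Finset.card_map (Function.Embedding.subtype _)]
      congr 1
      ext c
      simp [and_comm]
    exact ⟨Fintype.equivOfCardEq (by rw [hcount, hcount, h])⟩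
  let φ : x.cycles ≃ x'.cycles := Equiv.ofFiberEquiv (f := fun c => x.cycleIndex c)
    (g := fun c => x'.cycleIndex c) fun v => (key v).some
  refine ⟨φ, fun c => ?_⟩
  have hφ : x'.cycleIndex (φ c) = x.cycleIndex c := Equiv.ofFiberEquiv_map (f := fun c : x.cycles =>
    x.cycleIndex c) (g := fun c : x'.cycles => x'.cycleIndex c) (fun v => (key v).some) c
  obtain ⟨h1, h2⟩ := Prod.ext_iff.1 hφ
  refine ⟨?_, h1⟩
  have h3 := congrArg PNat.val h2
  simpa [cycleIndex, Nat.toPNat'_coe, card_pos_of_mem_cycles c.2,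
    card_pos_of_mem_cycles (φ c).2] using h3

/-- Two elements with the same colored partition are conjugate. -/
theorem isConj_of_coloredType_eq {x x' : GroupGm1n m n} (h : x.coloredType = x'.coloredType) :
    ∃ y, y * x * y⁻¹ = x' := by
  classical
  obtain ⟨φ, hφ⟩ := exists_cycles_equiv h
  have hb : ∀ c : x.cycles, ∃ b, x.perm.cycleFinset b = c := fun c => mem_cycles.1 c.2
  have hb' : ∀ c : x'.cycles, ∃ b, x'.perm.cycleFinset b = c := fun c => mem_cycles.1 c.2
  choose b hb using hb
  choose b' hb' using hb'
  have he : ∀ k, ∃ e : ℕ, (x.perm ^ e) (b ⟨_, cycleFinset_mem_cycles x k⟩) = k := fun k => by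
    refine Equiv.Perm.SameCycle.exists_nat_pow_eq (Equiv.Perm.cycleFinset_eq_iff.1 ?_)
    rw [hb]
  choose e he using he
  let C : Fin n → x.cycles := fun k => ⟨_, cycleFinset_mem_cycles x k⟩
  have hC : ∀ c (s : ℕ), C ((x.perm ^ s) (b c)) = c := fun c s => by
    apply Subtype.ext
    show x.perm.cycleFinset _ = _
    rw [Equiv.Perm.cycleFinset_eq_of_mem (Equiv.Perm.pow_apply_mem_cycleFinset _ _ _), hb]
  have hL' : ∀ c, (x'.perm.cycleFinset (b' (φ c))).card = (x.perm.cycleFinset (b c)).card :=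
    fun c => by rw [hb', hb, (hφ c).1]
  have hα' : ∀ c, x'.colorSum (x'.perm.cycleFinset (b' (φ c))) =
      x.colorSum (x.perm.cycleFinset (b c)) := fun c => by rw [hb', hb, (hφ c).2]
  let p : Fin n → Fin n := fun k => (x'.perm ^ e k) (b' (φ (C k)))
  let g : Fin n → ZMod m := fun k =>
    (x' ^ e k).color (b' (φ (C k))) - (x ^ e k).color (b (C k))
  have hmod : ∀ c (s : ℕ), e ((x.perm ^ s) (b c)) % (x.perm.cycleFinset (b c)).card =
      s % (x.perm.cycleFinset (b c)).card := fun c s => by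
    rw [← pow_apply_eq_iff_mod x (b c) rfl]
    have := he ((x.perm ^ s) (b c))
    rwa [show (⟨_, cycleFinset_mem_cycles x ((x.perm ^ s) (b c))⟩ : x.cycles) = c from hC c s]
      at this
  have hp : ∀ c (s : ℕ), p ((x.perm ^ s) (b c)) = (x'.perm ^ s) (b' (φ c)) := fun c s => by
    simp only [p]
    rw [hC, pow_apply_eq_iff_mod x' _ (hL' c), hmod]
  have hg : ∀ c (s : ℕ), g ((x.perm ^ s) (b c)) =
      (x' ^ s).color (b' (φ c)) - (x ^ s).color (b c) := fun c s => by
    simp only [g]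
    rw [hC, (pow_eq_pow_mod x' _ (hL' c) (hα' c) _).2, (pow_eq_pow_mod x (b c) rfl rfl _).2,
      (pow_eq_pow_mod x' _ (hL' c) (hα' c) s).2, (pow_eq_pow_mod x (b c) rfl rfl s).2, hmod]
    ring
  have hex : ∀ k, ∃ (c : x.cycles) (s : ℕ), (x.perm ^ s) (b c) = k := fun k => ⟨C k, e k, he k⟩
  have hinj : Function.Injective p := by
    intro k k' hkk
    obtain ⟨c, s, rfl⟩ := hex k
    obtain ⟨c', s', rfl⟩ := hex k'
    rw [hp, hp] at hkk
    have hcc : c = c' := by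
      apply φ.injective
      apply Subtype.ext
      rw [← hb' (φ c), ← hb' (φ c'),
        ← Equiv.Perm.cycleFinset_eq_of_mem (Equiv.Perm.pow_apply_mem_cycleFinset _ (b' (φ c)) s),
        hkk, Equiv.Perm.cycleFinset_eq_of_mem (Equiv.Perm.pow_apply_mem_cycleFinset _ _ _)]
    subst hcc
    rwa [pow_apply_eq_iff_mod x' _ (hL' c), ← pow_apply_eq_iff_mod x _ rfl] at hkk
  refine ⟨⟨Equiv.ofBijective p (Finite.injective_iff_bijective.mp hinj), g⟩, ?_⟩
  rw [mul_inv_eq_iff_eq_mul]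
  have hstep : ∀ c (s : ℕ), x.perm ((x.perm ^ s) (b c)) = (x.perm ^ (s + 1)) (b c) :=
    fun c s => by rw [pow_succ', Equiv.Perm.mul_apply]
  refine GroupGm1n.ext (Equiv.ext fun k => ?_) (funext fun k => ?_)
  · obtain ⟨c, s, rfl⟩ := hex k
    show p (x.perm _) = x'.perm (p _)
    rw [hstep, hp, hp, pow_succ', Equiv.Perm.mul_apply]
  · obtain ⟨c, s, rfl⟩ := hex k
    show g (x.perm _) + x.color _ = x'.color (p _) + g _
    rw [hstep, hp, hg, hg, pow_succ' x', pow_succ' x, mul_color, mul_color, pow_perm, pow_perm]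
    ring

end GroupGm1n

namespace ColoredPartition

variable {m : ℕ} [NeZero m]

/-- The multiset of all colored parts. -/
def parts (lam : ColoredPartition m) : Multiset (ZMod m × ℕ+) :=
  ∑ α : ZMod m, (lam α).map (Prod.mk α)

theorem count_parts (lam : ColoredPartition m) (v : ZMod m × ℕ+) :
    lam.parts.count v = (lam v.1).count v.2 := by
  classical
  rw [parts, Multiset.count_sum', Finset.sum_eq_single v.1]
  · exact Multiset.count_map_eq_count' (Prod.mk v.1) _ (Prod.mk_right_injective _) v.2
  · intro α _ hα
    rw [Multiset.count_eq_zero, Multiset.mem_map]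
    rintro ⟨i, -, rfl⟩
    exact hα rfl
  · simp

theorem parts_injective : Function.Injective (parts : ColoredPartition m → _) := by
  intro lam mu h
  funext α
  ext i
  rw [← count_parts lam (α, i), ← count_parts mu (α, i), h]

theorem parts_surjective : Function.Surjective (parts : ColoredPartition m → _) := by
  classical
  intro M
  refine ⟨fun α => (M.filter fun v => v.1 = α).map Prod.snd, ?_⟩
  ext v
  rw [count_parts, Multiset.count_map, Multiset.filter_filter, ← Multiset.countP_eq_card_filter,
    Multiset.count]
  refine Multiset.countP_congr rfl fun w _ => ?_
  rw [Prod.ext_iff, and_comm, eq_comm, @eq_comm _ v.1]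

theorem size_eq_sum_parts (lam : ColoredPartition m) :
    lam.size = (lam.parts.map fun v => (v.2 : ℕ)).sum := by
  have h := map_sum (Multiset.sumAddMonoidHom.comp
    (Multiset.mapAddMonoidHom fun v : ZMod m × ℕ+ => (v.2 : ℕ)))
    (fun α => (lam α).map (Prod.mk α)) Finset.univ
  simp only [AddMonoidHom.comp_apply, Multiset.coe_mapAddMonoidHom,
    Multiset.coe_sumAddMonoidHom, Multiset.map_map] at h
  rw [parts, h]
  rfl

theorem powerSumMonomial_eq_prod_parts (lam : ColoredPartition m) :
    powerSumMonomial lam = (lam.parts.map X).prod := by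
  classical
  rw [powerSumMonomial, parts, ← Multiset.coe_mapAddMonoidHom, map_sum, Multiset.prod_sum]
  simp

theorem powerSumMonomial_eq_monomial (lam : ColoredPartition m) :
    powerSumMonomial lam = monomial (Multiset.toFinsupp lam.parts) 1 := by
  rw [powerSumMonomial_eq_prod_parts]
  induction lam.parts using Multiset.induction_on with
  | empty => simp
  | cons v M ih =>
    rw [Multiset.map_cons, Multiset.prod_cons, ih, ← Multiset.singleton_add, map_add,
      Multiset.toFinsupp_singleton, X, monomial_mul, one_mul]

theorem weight_toFinsupp_parts (lam : ColoredPartition m) :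
    Finsupp.weight (fun v : ZMod m × ℕ+ => (v.2 : ℕ)) (Multiset.toFinsupp lam.parts) =
      lam.size := by
  rw [size_eq_sum_parts]
  induction lam.parts using Multiset.induction_on with
  | empty => simp
  | cons v M ih =>
    rw [← Multiset.singleton_add, map_add, map_add, ih, Multiset.toFinsupp_singleton]
    simp [Finsupp.weight_apply]

theorem powerSumMonomial_mem (lam : ColoredPartition m) :
    powerSumMonomial lam ∈ weightedHomogeneousSubmodule ℂ
      (fun v : ZMod m × ℕ+ => (v.2 : ℕ)) lam.size := by
  rw [powerSumMonomial_eq_monomial, mem_weightedHomogeneousSubmodule]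
  exact isWeightedHomogeneous_monomial _ _ _ (weight_toFinsupp_parts lam)

/-- The monomials `p_λ`, `|λ| = n`, span the homogeneous component of degree `n`. -/
theorem mem_span_powerSumMonomial {n : ℕ} {f : PowerSumRing m} 
    (hf : f ∈ weightedHomogeneousSubmodule ℂ (fun v : ZMod m × ℕ+ => (v.2 : ℕ)) n) :
    f ∈ Submodule.span ℂ (powerSumMonomial '' {lam : ColoredPartition m | lam.size = n}) := by
  rw [mem_weightedHomogeneousSubmodule] at hf
  rw [f.as_sum]
  refine Submodule.sum_mem _ fun d hd => ?_
  obtain ⟨lam, hlam⟩ := parts_surjective (Finsupp.toMultiset d)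
  have hd' : d = Multiset.toFinsupp lam.parts := by rw [hlam, Finsupp.toMultiset_toFinsupp]
  have hsz : lam.size = n := by
    rw [← weight_toFinsupp_parts, ← hd']
    exact hf (mem_support_iff.1 hd)
  have : monomial d (coeff d f) = coeff d f • powerSumMonomial lam := by
    rw [powerSumMonomial_eq_monomial, ← hd', smul_monomial, smul_eq_mul, mul_one]
  rw [this]
  exact Submodule.smul_mem _ _ (Submodule.subset_span ⟨lam, hsz, rfl⟩)

theorem linearIndependent_powerSumMonomial :
    LinearIndependent ℂ (powerSumMonomial : ColoredPartition m → PowerSumRing m) := by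
  have h := (basisMonomials (ZMod m × ℕ+) ℂ).linearIndependent.comp
    (fun lam : ColoredPartition m => Multiset.toFinsupp lam.parts)
    (Multiset.toFinsupp.injective.comp parts_injective)
  have h' : (powerSumMonomial : ColoredPartition m → PowerSumRing m) =
      basisMonomials (ZMod m × ℕ+) ℂ ∘ fun lam => Multiset.toFinsupp lam.parts := by
    funext lam
    rw [powerSumMonomial_eq_monomial, Function.comp_apply, coe_basisMonomials]
  rw [h']
  exact h

end ColoredPartition

namespace GroupGm1n

variable {m n : ℕ} [NeZero m]

theorem parts_coloredType (x : GroupGm1n m n) :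
    x.coloredType.parts = x.cycles.val.map x.cycleIndex := by
  classical
  ext v
  rw [ColoredPartition.count_parts, count_coloredType, Multiset.count_map, ← Finset.filter_val,
    ← Finset.card_def]
  simp only [eq_comm]

theorem powerSumMonomial_coloredType (x : GroupGm1n m n) :
    powerSumMonomial x.coloredType = ∏ c ∈ x.cycles, X (x.cycleIndex c) := by
  rw [ColoredPartition.powerSumMonomial_eq_prod_parts, parts_coloredType, Multiset.map_map]
  rfl

theorem size_coloredType (x : GroupGm1n m n) : x.coloredType.size = n := by
  rw [ColoredPartition.size_eq_sum_parts, parts_coloredType, Multiset.map_map]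
  have h := sum_eq_sum_cycles x fun _ => 1
  simp only [Finset.sum_const, Finset.card_univ, Fintype.card_fin, smul_eq_mul, mul_one] at h
  conv_rhs => rw [h]
  refine Finset.sum_congr rfl fun c hc => ?_
  simp [cycleIndex, Nat.toPNat'_coe, card_pos_of_mem_cycles hc]

omit [NeZero m] in
theorem exists_cycles_map_eq {k : ℕ} (f : Fin k → ZMod m × ℕ+)
    (hf : ∑ t, ((f t).2 : ℕ) = n) :
    ∃ x : GroupGm1n m n, x.cycles.val.map x.cycleIndex = Finset.univ.val.map f := by
  classical
  have hcard : Fintype.card (Σ t, ZMod ((f t).2 : ℕ)) = Fintype.card (Fin n) := by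
    simp [ZMod.card, hf]
  let E := Fintype.equivOfCardEq hcard
  let u : Equiv.Perm (Fin n) :=
    E.permCongr (Equiv.sigmaCongrRight fun t => Equiv.addRight (1 : ZMod ((f t).2 : ℕ)))
  let x : GroupGm1n m n :=
    ⟨u, fun k => if (E.symm k).2 = 0 then (f (E.symm k).1).1 else 0⟩
  have hpow : ∀ t (e : ℕ) (s : ZMod ((f t).2 : ℕ)), (u ^ e) (E ⟨t, s⟩) = E ⟨t, s + e⟩ := by
    intro t e
    induction e with
    | zero => simp
    | succ e ih =>
      intro s
      rw [pow_succ', Equiv.Perm.mul_apply, ih]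
      simp [u, add_assoc]
  let F : Fin k → Finset (Fin n) := fun t =>
    Finset.univ.image fun s : ZMod ((f t).2 : ℕ) => E ⟨t, s⟩
  have hE : ∀ t, Function.Injective fun s : ZMod ((f t).2 : ℕ) => E ⟨t, s⟩ :=
    fun t s s' h => by simpa using h
  have hF : ∀ t s, u.cycleFinset (E ⟨t, s⟩) = F t := by
    intro t s
    ext k
    simp only [Equiv.Perm.mem_cycleFinset, F, Finset.mem_image, Finset.mem_univ, true_and]
    constructor
    · intro h
      obtain ⟨e, rfl⟩ := h.exists_nat_pow_eq
      exact ⟨s + e, (hpow t e s).symm⟩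
    · rintro ⟨s', rfl⟩
      refine ⟨((s' - s).val : ℤ), ?_⟩
      rw [zpow_natCast, hpow, ZMod.natCast_zmod_val, add_sub_cancel]
  have hinj : Function.Injective F := by
    intro t t' h
    have : E ⟨t, 0⟩ ∈ F t' := h ▸ Finset.mem_image_of_mem _ (Finset.mem_univ _)
    simp only [F, Finset.mem_image, Finset.mem_univ, true_and,
      EmbeddingLike.apply_eq_iff_eq, Sigma.mk.injEq] at this
    obtain ⟨_, h, _⟩ := this
    exact h.symm
  have hcyc : x.cycles = Finset.univ.map ⟨F, hinj⟩ := by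
    ext c
    rw [mem_cycles]
    simp only [Finset.mem_map, Finset.mem_univ, true_and, Function.Embedding.coeFn_mk]
    constructor
    · rintro ⟨i, rfl⟩
      obtain ⟨⟨t, s⟩, rfl⟩ := E.surjective i
      exact ⟨t, (hF t s).symm⟩
    · rintro ⟨t, rfl⟩
      exact ⟨_, hF t 0⟩
  refine ⟨x, ?_⟩
  rw [hcyc, Finset.map_val, Multiset.map_map]
  refine Multiset.map_congr rfl fun t _ => ?_
  refine Prod.ext ?_ (PNat.eq ?_)
  · show ∑ i ∈ Finset.univ.image _, x.color i = _
    rw [Finset.sum_image (hE t).injOn]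
    have hx : ∀ s, x.color (E ⟨t, s⟩) = if s = 0 then (f t).1 else 0 := fun s => by
      simp only [x]
      rw [E.symm_apply_apply]
    simp [hx]
  · show ((Finset.univ.image _).card.toPNat' : ℕ) = _
    rw [Finset.card_image_of_injective _ (hE t)]
    simp [ZMod.card]

/-- Every colored partition of `n` is the colored partition of some element. -/
theorem exists_coloredType_eq (lam : ColoredPartition m) (h : lam.size = n) :
    ∃ x : GroupGm1n m n, x.coloredType = lam := by
  obtain ⟨s, hs⟩ := Quot.exists_rep lam.parts
  have hs' : lam.parts = Finset.univ.val.map s.get := by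
    rw [← hs, Fin.univ_val_map, List.ofFn_get]
    rfl
  rw [ColoredPartition.size_eq_sum_parts, hs', Multiset.map_map] at h
  obtain ⟨x, hx⟩ := exists_cycles_map_eq s.get h
  exact ⟨x, ColoredPartition.parts_injective (by rw [parts_coloredType, hx, hs'])⟩

end GroupGm1n

theorem MvPolynomial.pderiv_prod_X {σ κ R : Type*} [DecidableEq σ] [DecidableEq κ]
    [CommSemiring R] (w : σ) (S : Finset κ)
    (v : κ → σ) :
    pderiv w (∏ c ∈ S, (X (v c) : MvPolynomial σ R)) =
      ∑ c ∈ S, if v c = w then ∏ d ∈ S.erase c, X (v d) else 0 := by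
  induction S using Finset.induction_on with
  | empty => simp
  | insert a S ha ih =>
    rw [Finset.prod_insert ha, Derivation.leibniz, ih, Finset.sum_insert ha,
      Finset.erase_insert ha, pderiv_X, Pi.single_apply, add_comm, smul_eq_mul, smul_eq_mul,
      Finset.mul_sum]
    congr 1
    · simp only [mul_ite, mul_one, mul_zero, eq_comm]
    · refine Finset.sum_congr rfl fun c hc => ?_
      have hca : a ≠ c := fun h => ha (h ▸ hc)
      rw [Finset.erase_insert_of_ne hca, Finset.prod_insert fun h => ha (Finset.mem_of_mem_erase h)]
      split_ifs <;> simp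

section Formula

variable {m : ℕ}

theorem cutJoinFormula_add (k : ZMod m) (f g : PowerSumRing m) :
    cutJoinFormula k (f + g) = cutJoinFormula k f + cutJoinFormula k g := by
  rw [cutJoinFormula, cutJoinFormula, cutJoinFormula,
    ← finsum_add_distrib (eulerTerm_finite k f) (eulerTerm_finite k g)]
  exact finsum_congr fun q => by rw [map_add, mul_add, smul_add]

theorem cutJoinFormula_smul (k : ZMod m) (a : ℂ) (f : PowerSumRing m) :
    cutJoinFormula k (a • f) = a • cutJoinFormula k f := by
  rw [cutJoinFormula, cutJoinFormula, smul_finsum' a (eulerTerm_finite k f)]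
  exact finsum_congr fun q => by rw [Derivation.map_smul, mul_smul_comm, smul_comm]

theorem cutJoinFormulaZero_add [NeZero m] (f g : PowerSumRing m) :
    cutJoinFormulaZero (f + g) = cutJoinFormulaZero f + cutJoinFormulaZero g := by
  rw [cutJoinFormulaZero, cutJoinFormulaZero, cutJoinFormulaZero, ← smul_add,
    ← finsum_add_distrib (cutJoinTerm_finite f) (cutJoinTerm_finite g)]
  congr 1
  refine finsum_congr fun q => ?_
  simp only [cutJoinTerm, map_add, mul_add, smul_add]
  abel

theorem cutJoinFormulaZero_smul [NeZero m] (a : ℂ) (f : PowerSumRing m) :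
    cutJoinFormulaZero (a • f) = a • cutJoinFormulaZero f := by
  rw [cutJoinFormulaZero, cutJoinFormulaZero, smul_comm a, smul_finsum' a (cutJoinTerm_finite f)]
  congr 1
  refine finsum_congr fun q => ?_
  simp only [cutJoinTerm, Derivation.map_smul, mul_smul_comm, smul_add]
  rw [smul_comm, smul_comm (_ : ℂ) a]

/-- The operator `f ↦ ∑ i p_i^{(α+k)} ∂f/∂p_i^{(α)}` as a linear map. -/
noncomputable def cutJoinLinear (k : ZMod m) : PowerSumRing m →ₗ[ℂ] PowerSumRing m where
  toFun := cutJoinFormula k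
  map_add' := cutJoinFormula_add k
  map_smul' := cutJoinFormula_smul k

/-- The cut-and-join operator of index zero as a linear map. -/
noncomputable def cutJoinLinearZero [NeZero m] : PowerSumRing m →ₗ[ℂ] PowerSumRing m where
  toFun := cutJoinFormulaZero
  map_add' := cutJoinFormulaZero_add
  map_smul' := cutJoinFormulaZero_smul

variable {κ : Type*} [DecidableEq κ] (S : Finset κ) (v : κ → ZMod m × ℕ+)

theorem cutJoinFormula_prod_X (k : ZMod m) :
    cutJoinFormula k (∏ c ∈ S, (X (v c) : PowerSumRing m)) =
      ∑ c ∈ S, (((v c).2 : ℕ) : ℂ) • (X ((v c).1 + k, (v c).2) * ∏ d ∈ S.erase c, X (v d)) := by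
  classical
  have hterm : ∀ q : ℕ+ × ZMod m, ((q.1 : ℕ) : ℂ) •
      (X (q.2 + k, q.1) * pderiv (q.2, q.1) (∏ c ∈ S, (X (v c) : PowerSumRing m))) =
      ∑ c ∈ S, if v c = (q.2, q.1) then
        (((v c).2 : ℕ) : ℂ) • (X ((v c).1 + k, (v c).2) * ∏ d ∈ S.erase c, X (v d)) else 0 := by
    intro q
    rw [pderiv_prod_X, Finset.mul_sum, Finset.smul_sum]
    refine Finset.sum_congr rfl fun c _ => ?_
    split_ifs with h
    · rw [h]
    · simp
  rw [cutJoinFormula, finsum_congr hterm, finsum_sum_comm]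
  · refine Finset.sum_congr rfl fun c _ => ?_
    rw [finsum_eq_single _ ((v c).2, (v c).1)]
    · simp
    · rintro ⟨i, α⟩ h
      rw [if_neg]
      intro h'
      exact h (by rw [h'])
  · intro c _
    refine (Set.finite_singleton ((v c).2, (v c).1)).subset ?_
    rintro ⟨i, α⟩ h
    by_contra h'
    apply h
    simp only
    rw [if_neg]
    intro h''
    exact h' (by rw [h'']; rfl)

/-- The two-element decompositions of a colored part. -/
theorem sum_cut_eq [NeZero m] (w : ZMod m × ℕ+) (R : PowerSumRing m) :
    (Function.support fun q : (ℕ+ × ℕ+) × ZMod m × ZMod m =>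
      if w = (q.2.1 + q.2.2, q.1.1 + q.1.2) then
        ((w.2 : ℕ) : ℂ) • (X (q.2.1, q.1.1) * X (q.2.2, q.1.2) * R) else 0).Finite ∧
    ∑ᶠ q : (ℕ+ × ℕ+) × ZMod m × ZMod m, (if w = (q.2.1 + q.2.2, q.1.1 + q.1.2) then
        ((w.2 : ℕ) : ℂ) • (X (q.2.1, q.1.1) * X (q.2.2, q.1.2) * R) else 0) =
      ∑ a ∈ Finset.Ico 1 (w.2 : ℕ), ∑ β : ZMod m, ((w.2 : ℕ) : ℂ) •
        (X (β, a.toPNat') * X (w.1 - β, ((w.2 : ℕ) - a).toPNat') * R) := by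
  classical
  let e : ℕ × ZMod m → (ℕ+ × ℕ+) × ZMod m × ZMod m := fun p =>
    ((p.1.toPNat', ((w.2 : ℕ) - p.1).toPNat'), (p.2, w.1 - p.2))
  have he : Set.InjOn e (Finset.Ico 1 (w.2 : ℕ) ×ˢ (Finset.univ : Finset (ZMod m)) : Finset _) := by
    rintro ⟨a, β⟩ ha ⟨b, γ⟩ hb h
    simp only [Finset.coe_product, Set.mem_prod, Finset.coe_Ico, Set.mem_Ico] at ha hb
    simp only [e, Prod.mk.injEq] at h
    refine Prod.ext ?_ h.2.1
    have := congrArg PNat.val h.1.1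
    simpa [Nat.toPNat'_coe, show 0 < a by omega, show 0 < b by omega] using this
  have hsupp : (Function.support fun q : (ℕ+ × ℕ+) × ZMod m × ZMod m =>
      if w = (q.2.1 + q.2.2, q.1.1 + q.1.2) then
        ((w.2 : ℕ) : ℂ) • (X (q.2.1, q.1.1) * X (q.2.2, q.1.2) * R) else 0) ⊆
      ((Finset.Ico 1 (w.2 : ℕ) ×ˢ (Finset.univ : Finset (ZMod m))).image e : Finset _) := by
    rintro ⟨⟨i, j⟩, α, γ⟩ h
    simp only [Function.mem_support, ne_eq, ite_eq_right_iff, not_forall] at h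
    obtain ⟨rfl, -⟩ := h
    have hi := i.pos
    have hj := j.pos
    simp only [Finset.coe_image, Set.mem_image, Finset.mem_coe, Finset.mem_product,
      Finset.mem_Ico, Finset.mem_univ, and_true]
    refine ⟨((i : ℕ), α), by simp only [PNat.add_coe]; omega, ?_⟩
    simp [e]
  refine ⟨(Finset.finite_toSet _).subset hsupp, ?_⟩
  rw [finsum_eq_sum_of_support_subset _ hsupp, Finset.sum_image he, Finset.sum_product]
  refine Finset.sum_congr rfl fun a ha => Finset.sum_congr rfl fun β _ => if_pos ?_
  rw [Finset.mem_Ico] at ha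
  refine Prod.ext (by simp [e]) (PNat.eq ?_)
  simp only [e, PNat.add_coe, Nat.toPNat'_coe]
  rw [if_pos (by omega), if_pos (by omega)]
  omega

theorem cutJoinFormulaZero_prod_X [NeZero m] :
    cutJoinFormulaZero (∏ c ∈ S, (X (v c) : PowerSumRing m)) = (1 / 2 : ℂ) •
      ((∑ c ∈ S, ∑ a ∈ Finset.Ico 1 ((v c).2 : ℕ), ∑ β : ZMod m, (((v c).2 : ℕ) : ℂ) •
        (X (β, a.toPNat') * X ((v c).1 - β, (((v c).2 : ℕ) - a).toPNat') *
          ∏ d ∈ S.erase c, X (v d))) +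
      ∑ c ∈ S, ∑ c' ∈ S.erase c, ((m * ((v c).2 : ℕ) * ((v c').2 : ℕ) : ℕ) : ℂ) •
        (X ((v c).1 + (v c').1, (v c).2 + (v c').2) *
          ∏ d ∈ (S.erase c).erase c', X (v d))) := by
  classical
  have h1 : ∀ q : (ℕ+ × ℕ+) × ZMod m × ZMod m,
      (((q.1.1 : ℕ) + (q.1.2 : ℕ) : ℕ) : ℂ) • (X (q.2.1, q.1.1) * X (q.2.2, q.1.2) *
        pderiv (q.2.1 + q.2.2, q.1.1 + q.1.2) (∏ c ∈ S, (X (v c) : PowerSumRing m))) =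
      ∑ c ∈ S, if v c = (q.2.1 + q.2.2, q.1.1 + q.1.2) then
        (((v c).2 : ℕ) : ℂ) • (X (q.2.1, q.1.1) * X (q.2.2, q.1.2) *
          ∏ d ∈ S.erase c, X (v d)) else 0 := by
    intro q
    rw [pderiv_prod_X, Finset.mul_sum, Finset.smul_sum]
    refine Finset.sum_congr rfl fun c _ => ?_
    split_ifs with h
    · rw [h, PNat.add_coe]
    · simp
  have h2 : ∀ q : (ℕ+ × ℕ+) × ZMod m × ZMod m,
      ((m * (q.1.1 : ℕ) * (q.1.2 : ℕ) : ℕ) : ℂ) • (X (q.2.1 + q.2.2, q.1.1 + q.1.2) *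
        pderiv (q.2.1, q.1.1) (pderiv (q.2.2, q.1.2) (∏ c ∈ S, (X (v c) : PowerSumRing m)))) =
      ∑ c' ∈ S, ∑ c ∈ S.erase c',
        if ((((v c).2, (v c').2), ((v c).1, (v c').1)) : (ℕ+ × ℕ+) × ZMod m × ZMod m) = q then
        ((m * ((v c).2 : ℕ) * ((v c').2 : ℕ) : ℕ) : ℂ) •
          (X ((v c).1 + (v c').1, (v c).2 + (v c').2) *
          ∏ d ∈ (S.erase c').erase c, X (v d)) else 0 := by
    rintro ⟨⟨i, j⟩, α, γ⟩
    rw [pderiv_prod_X, map_sum, Finset.mul_sum, Finset.smul_sum]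
    refine Finset.sum_congr rfl fun c' _ => ?_
    by_cases h' : v c' = (γ, j)
    · rw [if_pos h']
      rw [pderiv_prod_X, Finset.mul_sum, Finset.smul_sum]
      refine Finset.sum_congr rfl fun c _ => ?_
      by_cases h : v c = (α, i)
      · rw [if_pos h, if_pos (by rw [h, h']), h, h']
      · rw [if_neg h, if_neg, mul_zero, smul_zero]
        intro hq
        simp only [Prod.mk.injEq] at hq
        exact h (Prod.ext hq.2.1 hq.1.1)
    · rw [if_neg h', map_zero, mul_zero, smul_zero]
      symm
      refine Finset.sum_eq_zero fun c _ => if_neg fun hq => ?_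
      simp only [Prod.mk.injEq] at hq
      exact h' (Prod.ext hq.2.2 hq.1.2)
  have hs1 := fun c : κ => sum_cut_eq (v c) (∏ d ∈ S.erase c, X (v d))
  have hs2 : ∀ (q₀ : (ℕ+ × ℕ+) × ZMod m × ZMod m) (P : PowerSumRing m),
      (Function.support fun q => if q₀ = q then P else 0).Finite := by
    intro q₀ P
    refine (Set.finite_singleton q₀).subset fun q hq => ?_
    by_contra h
    exact hq (if_neg fun h' => h h'.symm)
  have hs2' : ∀ (q₀ : (ℕ+ × ℕ+) × ZMod m × ZMod m) (P : PowerSumRing m),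
      ∑ᶠ q, (if q₀ = q then P else 0) = P := by
    intro q₀ P
    rw [finsum_eq_single _ q₀ fun q hq => if_neg fun h => hq h.symm, if_pos rfl]
  have hs : ∀ (T : Finset κ) (f : κ → (ℕ+ × ℕ+) × ZMod m × ZMod m → PowerSumRing m),
      (∀ c, (Function.support (f c)).Finite) →
        (Function.support fun q => ∑ c ∈ T, f c q).Finite := fun T f hf =>
    (T.finite_toSet.biUnion fun c _ => hf c).subset (Finset.support_sum T f)
  rw [cutJoinFormulaZero]
  congr 1
  simp only [cutJoinTerm]
  rw [finsum_congr fun q => congrArg₂ (· + ·) (h1 q) (h2 q), finsum_add_distrib]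
  · congr 1
    · rw [finsum_sum_comm _ _ fun c _ => (hs1 c).1]
      exact Finset.sum_congr rfl fun c _ => (hs1 c).2
    · rw [finsum_sum_comm]
      · refine Finset.sum_congr rfl fun c' _ => ?_
        rw [finsum_sum_comm _ _ fun c _ => hs2 _ _]
        refine Finset.sum_congr rfl fun c _ => ?_
        rw [hs2', add_comm (v c).1, add_comm (v c).2, mul_right_comm]
      · exact fun c' _ => hs _ _ fun c => hs2 _ _
  · exact hs S _ fun c => (hs1 c).1
  · exact hs S _ fun c' => hs _ _ fun c => hs2 _ _

end Formula

namespace GroupGm1n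

variable {m n : ℕ}

section Cycles

theorem mem_cycles_r_mul {x : GroupGm1n m n} {i j : Fin n} {α : ZMod m} {d : Finset (Fin n)} :
    d ∈ (r i j α * x).cycles ↔ d = (r i j α * x).perm.cycleFinset i ∨
      d = (r i j α * x).perm.cycleFinset j ∨ (d ∈ x.cycles ∧ i ∉ d ∧ j ∉ d) := by
  have hx : Equiv.swap i j * (r i j α * x).perm = x.perm := by
    rw [r_mul_perm, ← mul_assoc, Equiv.swap_mul_self, one_mul]
  constructor
  · intro hd
    by_cases hi : i ∈ d
    · exact Or.inl (cycleFinset_eq_of_mem_cycles hd hi).symm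
    by_cases hj : j ∈ d
    · exact Or.inr (Or.inl (cycleFinset_eq_of_mem_cycles hd hj).symm)
    obtain ⟨k, rfl⟩ := mem_cycles.1 hd
    refine Or.inr (Or.inr ⟨mem_cycles.2 ⟨k, ?_⟩, hi, hj⟩)
    rw [← Equiv.Perm.cycleFinset_swap_mul_of_notMem hi hj, hx]
  · rintro (rfl | rfl | ⟨hd, hi, hj⟩)
    · exact cycleFinset_mem_cycles _ _
    · exact cycleFinset_mem_cycles _ _
    · obtain ⟨k, rfl⟩ := mem_cycles.1 hd
      refine mem_cycles.2 ⟨k, ?_⟩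
      rw [r_mul_perm, Equiv.Perm.cycleFinset_swap_mul_of_notMem hi hj]

theorem cycleIndex_r_mul_of_notMem {x : GroupGm1n m n} {i j : Fin n} {α : ZMod m}
    {d : Finset (Fin n)} (hd : d ∈ x.cycles) (hi : i ∉ d) (hj : j ∉ d) :
    (r i j α * x).cycleIndex d = x.cycleIndex d := by
  rw [cycleIndex, colorSum_r_mul _ _ _ _ (mem_cycles_r_mul.2 (Or.inr (Or.inr ⟨hd, hi, hj⟩))),
    if_neg hi, if_neg hj, sub_zero, add_zero, cycleIndex]

theorem notMem_iff_ne {x : GroupGm1n m n} {c d : Finset (Fin n)} {i : Fin n}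
    (hc : c ∈ x.cycles) (hi : i ∈ c) (hd : d ∈ x.cycles) : i ∉ d ↔ d ≠ c := by
  constructor
  · rintro h rfl
    exact h hi
  · intro h hid
    exact h ((cycleFinset_eq_of_mem_cycles hd hid).symm.trans (cycleFinset_eq_of_mem_cycles hc hi))

end Cycles

section Monomial

/-- The monomial attached to an element: the product over its cycles of the variables indexed by
the cycle product and the length. -/
noncomputable def cycleMonomial (x : GroupGm1n m n) : PowerSumRing m :=
  ∏ c ∈ x.cycles, X (x.cycleIndex c)

theorem toPNat'_add {a b : ℕ} (ha : 0 < a) (hb : 0 < b) :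
    (a + b).toPNat' = a.toPNat' + b.toPNat' := by
  refine PNat.eq ?_
  simp only [PNat.add_coe, Nat.toPNat'_coe, ha, hb, if_true]
  rw [if_pos (by omega)]

theorem cycleMonomial_r_mul_join {x : GroupGm1n m n} {c c' : Finset (Fin n)} (hc : c ∈ x.cycles)
    (hc' : c' ∈ x.cycles) (hne : c' ≠ c) {i j : Fin n} (hi : i ∈ c) (hj : j ∈ c') (α : ZMod m) :
    (r i j α * x).cycleMonomial =
      X ((x.cycleIndex c).1 + (x.cycleIndex c').1, (x.cycleIndex c).2 + (x.cycleIndex c').2) *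
        ∏ d ∈ (x.cycles.erase c).erase c', X (x.cycleIndex d) := by
  classical
  have hci := cycleFinset_eq_of_mem_cycles hc hi
  have hcj := cycleFinset_eq_of_mem_cycles hc' hj
  have hns : ¬ x.perm.SameCycle i j := fun h =>
    hne (by rw [← hci, ← hcj, Equiv.Perm.cycleFinset_eq_iff.2 h])
  have hA : (r i j α * x).perm.cycleFinset i = c ∪ c' := by
    rw [r_mul_perm, Equiv.Perm.cycleFinset_swap_mul_join hns, hci, hcj]
  have hB : (r i j α * x).perm.cycleFinset j = c ∪ c' := by
    rw [← hA]
    refine Equiv.Perm.cycleFinset_eq_of_mem ?_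
    rw [hA]
    exact Finset.mem_union_right _ hj
  have hdisj : Disjoint c c' := Finset.disjoint_left.2 fun k hk hk' =>
    (notMem_iff_ne hc hk hc').2 hne hk'
  have hmem : c ∪ c' ∈ (r i j α * x).cycles := hA ▸ cycleFinset_mem_cycles _ _
  have hcyc : (r i j α * x).cycles = insert (c ∪ c') ((x.cycles.erase c).erase c') := by
    ext d
    rw [mem_cycles_r_mul, hA, hB, Finset.mem_insert, Finset.mem_erase, Finset.mem_erase]
    have h1 := fun hd : d ∈ x.cycles => notMem_iff_ne hc hi hd
    have h2 := fun hd : d ∈ x.cycles => notMem_iff_ne hc' hj hd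
    have h3 : (d ∈ x.cycles ∧ i ∉ d ∧ j ∉ d) ↔ (d ≠ c' ∧ d ≠ c ∧ d ∈ x.cycles) :=
      ⟨fun h => ⟨(h2 h.1).1 h.2.2, (h1 h.1).1 h.2.1, h.1⟩,
        fun h => ⟨h.2.2, (h1 h.2.2).2 h.2.1, (h2 h.2.2).2 h.1⟩⟩
    rw [h3, or_self_left]
  rw [cycleMonomial, hcyc, Finset.prod_insert]
  · congr 1
    · rw [cycleIndex, colorSum_r_mul _ _ _ _ hmem, if_pos (Finset.mem_union_left _ hi),
        if_pos (Finset.mem_union_right _ hj), sub_self, add_zero, colorSum,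
        Finset.sum_union hdisj, Finset.card_union_of_disjoint hdisj,
        toPNat'_add (card_pos_of_mem_cycles hc) (card_pos_of_mem_cycles hc')]
      rfl
    · refine Finset.prod_congr rfl fun d hd => ?_
      rw [Finset.mem_erase, Finset.mem_erase] at hd
      rw [cycleIndex_r_mul_of_notMem hd.2.2 ((notMem_iff_ne hc hi hd.2.2).2 hd.2.1)
        ((notMem_iff_ne hc' hj hd.2.2).2 hd.1)]
  · intro h
    rw [Finset.mem_erase, Finset.mem_erase] at h
    exact (notMem_iff_ne hc hi h.2.2).2 h.2.1 (Finset.mem_union_left _ hi)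

theorem cycleMonomial_r_mul_cut {x : GroupGm1n m n} {i : Fin n} {a : ℕ} (ha : 0 < a)
    (haL : a < (x.perm.cycleFinset i).card) (α : ZMod m) :
    (r i ((x.perm ^ a) i) α * x).cycleMonomial =
      X (x.colorSum (x.perm.arc i a) - α, a.toPNat') *
      X (x.colorSum (x.perm.cycleFinset i) - (x.colorSum (x.perm.arc i a) - α),
        ((x.perm.cycleFinset i).card - a).toPNat') *
        ∏ d ∈ x.cycles.erase (x.perm.cycleFinset i), X (x.cycleIndex d) := by
  classical
  set j := (x.perm ^ a) i with hj
  set c := x.perm.cycleFinset i with hcdef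
  have hc : c ∈ x.cycles := cycleFinset_mem_cycles x i
  have hic : i ∈ c := Equiv.Perm.self_mem_cycleFinset _ _
  have hjc : j ∈ c := Equiv.Perm.pow_apply_mem_cycleFinset _ _ _
  have hcj : x.perm.cycleFinset j = c := cycleFinset_eq_of_mem_cycles hc hjc
  set A := x.perm.arc i a with hAdef
  set B := x.perm.arc j (c.card - a) with hBdef
  have hA : (r i j α * x).perm.cycleFinset i = A := Equiv.Perm.cycleFinset_swap_mul_cut ha haL
  have hB : (r i j α * x).perm.cycleFinset j = B := Equiv.Perm.cycleFinset_swap_mul_cut' ha haL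
  have hAmem : A ∈ (r i j α * x).cycles := hA ▸ cycleFinset_mem_cycles _ _
  have hBmem : B ∈ (r i j α * x).cycles := hB ▸ cycleFinset_mem_cycles _ _
  have hiA : i ∈ A := hA ▸ Equiv.Perm.self_mem_cycleFinset _ _
  have hjB : j ∈ B := hB ▸ Equiv.Perm.self_mem_cycleFinset _ _
  have hjA : j ∉ A := by
    rw [hAdef, Equiv.Perm.mem_arc]
    rintro ⟨s, hs, h⟩
    exact hs.ne (Equiv.Perm.pow_apply_injOn x.perm i (Set.mem_Iio.2 (hs.trans haL))
      (Set.mem_Iio.2 haL) h)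
  have hBA : B ≠ A := fun h => hjA (h ▸ hjB)
  have hiB : i ∉ B := (notMem_iff_ne hAmem hiA hBmem).2 hBA
  have hdisj : Disjoint A B := Finset.disjoint_left.2 fun k hk =>
    (notMem_iff_ne hAmem hk hBmem).2 hBA
  have hunion : c = A ∪ B := by
    rw [hAdef, hBdef, hj, ← Equiv.Perm.arc_add, Nat.add_sub_cancel' haL.le, hcdef,
      ← Equiv.Perm.cycleFinset_eq_arc]
  have hsum : x.colorSum c = x.colorSum A + x.colorSum B := by
    rw [hunion, colorSum, Finset.sum_union hdisj]
    rfl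
  have hcyc : (r i j α * x).cycles = insert A (insert B (x.cycles.erase c)) := by
    ext d
    rw [mem_cycles_r_mul, hA, hB, Finset.mem_insert, Finset.mem_insert, Finset.mem_erase]
    have h1 := fun hd : d ∈ x.cycles => notMem_iff_ne hc hic hd
    have h2 := fun hd : d ∈ x.cycles => notMem_iff_ne hc hjc hd
    have h3 : (d ∈ x.cycles ∧ i ∉ d ∧ j ∉ d) ↔ (d ≠ c ∧ d ∈ x.cycles) :=
      ⟨fun h => ⟨(h1 h.1).1 h.2.1, h.1⟩, fun h => ⟨h.2, (h1 h.2).2 h.1, (h2 h.2).2 h.1⟩⟩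
    rw [h3]
  have hcardA : A.card = a := Equiv.Perm.card_arc haL.le
  have hcardB : B.card = c.card - a := Equiv.Perm.card_arc (by rw [hcj]; omega)
  have hAi : (r i j α * x).cycleIndex A = (x.colorSum A - α, a.toPNat') := by
    rw [cycleIndex, colorSum_r_mul _ _ _ _ hAmem, if_pos hiA, if_neg hjA, hcardA, zero_sub,
      ← sub_eq_add_neg]
  have hBi : (r i j α * x).cycleIndex B =
      (x.colorSum c - (x.colorSum A - α), (c.card - a).toPNat') := by
    rw [cycleIndex, colorSum_r_mul _ _ _ _ hBmem, if_neg hiB, if_pos hjB, hcardB, sub_zero, hsum]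
    refine congrArg (fun β : ZMod m => (β, (c.card - a).toPNat')) ?_
    ring
  have hprod : ∏ d ∈ x.cycles.erase c, (X ((r i j α * x).cycleIndex d) : PowerSumRing m) =
      ∏ d ∈ x.cycles.erase c, X (x.cycleIndex d) := by
    refine Finset.prod_congr rfl fun d hd => ?_
    rw [Finset.mem_erase] at hd
    rw [cycleIndex_r_mul_of_notMem hd.2 ((notMem_iff_ne hc hic hd.2).2 hd.1)
      ((notMem_iff_ne hc hjc hd.2).2 hd.1)]
  rw [cycleMonomial, hcyc, Finset.prod_insert, Finset.prod_insert, hAi, hBi, hprod, mul_assoc]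
  · intro h
    rw [Finset.mem_erase] at h
    exact (notMem_iff_ne hc hjc h.2).2 h.1 hjB
  · intro h
    rw [Finset.mem_insert, Finset.mem_erase] at h
    rcases h with h | h
    · exact hBA h.symm
    · exact (notMem_iff_ne hc hic h.2).2 h.1 hiA

theorem cycleMonomial_l_mul {x : GroupGm1n m n} {c : Finset (Fin n)} (hc : c ∈ x.cycles)
    {i : Fin n} (hi : i ∈ c) (k : ZMod m) :
    (l i k * x).cycleMonomial = X ((x.cycleIndex c).1 + k, (x.cycleIndex c).2) *
      ∏ d ∈ x.cycles.erase c, X (x.cycleIndex d) := by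
  rw [cycleMonomial, cycles_congr (l_mul_perm i k x), ← Finset.mul_prod_erase _ _ hc]
  congr 1
  · rw [cycleIndex, colorSum_l_mul _ _ _ hc, if_pos hi]
    rfl
  · refine Finset.prod_congr rfl fun d hd => ?_
    rw [Finset.mem_erase] at hd
    rw [cycleIndex, colorSum_l_mul _ _ _ hd.2,
      if_neg ((notMem_iff_ne hc hi hd.2).2 hd.1), add_zero, cycleIndex]

end Monomial

section Reflections

variable [NeZero m]

omit [NeZero m] in
theorem l_injective {k : ZMod m} (hk : k ≠ 0) :
    Function.Injective fun i : Fin n => (l i k : GroupGm1n m n) := by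
  intro i j h
  have h' := congrFun (congrArg color h) i
  by_contra hij
  simp [l, hij, hk] at h'

theorem sum_reflectionClass {M : Type*} [AddCommMonoid M] {k : ZMod m} (hk : k ≠ 0)
    (f : GroupGm1n m n → M) : ∑ t ∈ reflectionClass m n k, f t = ∑ i, f (l i k) := by
  classical
  have h : reflectionClass m n k = Finset.univ.image fun i => l i k := by
    ext t
    simp [reflectionClass, hk, eq_comm]
  rw [h, Finset.sum_image (l_injective hk).injOn]

omit [NeZero m] in
theorem r_eq_r_iff {i j i' j' : Fin n} {α α' : ZMod m} (hij : i ≠ j) (hij' : i' ≠ j') :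
    r i' j' α' = r i j α ↔ (i' = i ∧ j' = j ∧ α' = α) ∨ (i' = j ∧ j' = i ∧ α' = -α) := by
  constructor
  · intro h
    have hp : ∀ k, Equiv.swap i' j' k = Equiv.swap i j k := fun k =>
      congrArg (fun t : GroupGm1n m n => t.perm k) h
    have hc := fun k => congrFun (congrArg color h) k
    have h1 := hp i'
    rw [Equiv.swap_apply_left] at h1
    by_cases hi : i' = i
    · subst hi
      rw [Equiv.swap_apply_left] at h1
      subst h1
      left
      simpa [r, hij'] using hc i'
    · by_cases hj : i' = j
      · subst hj
        rw [Equiv.swap_apply_right] at h1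
        subst h1
        right
        simpa [r, hij'] using hc i'
      · rw [Equiv.swap_apply_of_ne_of_ne hi hj] at h1
        exact absurd h1.symm hij'
  · rintro (⟨rfl, rfl, rfl⟩ | ⟨rfl, rfl, rfl⟩)
    · rfl
    · refine GroupGm1n.ext (Equiv.swap_comm _ _) ?_
      simp only [r, Pi.single_neg]
      abel

theorem two_nsmul_sum_reflectionClass {M : Type*} [AddCommMonoid M] (f : GroupGm1n m n → M) :
    2 • ∑ t ∈ reflectionClass m n 0, f t =
      ∑ i, ∑ j ∈ Finset.univ.erase i, ∑ α, f (r i j α) := by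
  classical
  let T : Finset (Fin n × Fin n × ZMod m) := Finset.univ.filter fun p => p.1 ≠ p.2.1
  have hmaps : ∀ p ∈ T, r p.1 p.2.1 p.2.2 ∈ reflectionClass m n 0 := by
    rintro ⟨i, j, α⟩ hp
    simp only [T, Finset.mem_filter, Finset.mem_univ, true_and] at hp
    simp only [reflectionClass, if_true, Finset.mem_filter, Finset.mem_univ, true_and]
    exact ⟨i, j, α, hp, rfl⟩
  have hT : ∑ p ∈ T, f (r p.1 p.2.1 p.2.2) =
      ∑ i, ∑ j ∈ Finset.univ.erase i, ∑ α, f (r i j α) := by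
    rw [Finset.sum_filter, Fintype.sum_prod_type]
    refine Finset.sum_congr rfl fun i _ => ?_
    rw [Fintype.sum_prod_type, ← Finset.filter_ne, Finset.sum_filter]
    refine Finset.sum_congr rfl fun j _ => ?_
    split_ifs <;> simp
  rw [← hT, ← Finset.sum_fiberwise_of_maps_to hmaps, Finset.smul_sum]
  refine Finset.sum_congr rfl fun t ht => ?_
  simp only [reflectionClass, if_true, Finset.mem_filter, Finset.mem_univ, true_and] at ht
  obtain ⟨i, j, α, hij, rfl⟩ := ht
  have hfib : (T.filter fun p => r p.1 p.2.1 p.2.2 = r i j α) = {(i, j, α), (j, i, -α)} := by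
    ext ⟨i', j', α'⟩
    simp only [T, Finset.mem_filter, Finset.mem_univ, true_and, Finset.mem_insert,
      Finset.mem_singleton, Prod.mk.injEq]
    constructor
    · rintro ⟨h1, h2⟩
      exact (r_eq_r_iff hij h1).1 h2
    · intro h
      have h1 : i' ≠ j' := by
        rcases h with ⟨rfl, rfl, -⟩ | ⟨rfl, rfl, -⟩
        · exact hij
        · exact hij.symm
      exact ⟨h1, (r_eq_r_iff hij h1).2 h⟩
  rw [Finset.sum_congr rfl fun p hp => congrArg f (Finset.mem_filter.1 hp).2, Finset.sum_const,
    hfib, Finset.card_pair]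
  simp [hij]

theorem sum_cycleMonomial_l_mul {k : ZMod m} (hk : k ≠ 0) (x : GroupGm1n m n) :
    ∑ t ∈ reflectionClass m n k, (t * x).cycleMonomial = cutJoinFormula k x.cycleMonomial := by
  rw [sum_reflectionClass (n := n) hk fun t => (t * x).cycleMonomial, sum_eq_sum_cycles x, cycleMonomial,
    cutJoinFormula_prod_X]
  refine Finset.sum_congr rfl fun c hc => ?_
  rw [Finset.sum_congr rfl fun i hi => cycleMonomial_l_mul hc hi k, Finset.sum_const,
    ← Nat.cast_smul_eq_nsmul ℂ]
  simp [cycleIndex, card_pos_of_mem_cycles hc]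

omit [NeZero m] in
theorem sum_erase_cycle {M : Type*} [AddCommMonoid M] (x : GroupGm1n m n) (i : Fin n)
    (f : Fin n → M) : ∑ j ∈ (x.perm.cycleFinset i).erase i, f j =
      ∑ a ∈ Finset.Ico 1 (x.perm.cycleFinset i).card, f ((x.perm ^ a) i) := by
  have hinj : Set.InjOn (fun a : ℕ => (x.perm ^ a) i)
      (Finset.Ico 1 (x.perm.cycleFinset i).card : Finset ℕ) :=
    (Equiv.Perm.pow_apply_injOn x.perm i).mono fun a ha => by
      simp only [Finset.coe_Ico, Set.mem_Ico] at ha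
      exact ha.2
  rw [← Finset.sum_image hinj]
  refine Finset.sum_congr ?_ fun _ _ => rfl
  ext j
  simp only [Finset.mem_erase, Finset.mem_image, Finset.mem_Ico]
  constructor
  · rintro ⟨hne, hj⟩
    rw [Equiv.Perm.cycleFinset_eq_arc, Equiv.Perm.mem_arc] at hj
    obtain ⟨a, ha, rfl⟩ := hj
    refine ⟨a, ⟨Nat.one_le_iff_ne_zero.2 ?_, ha⟩, rfl⟩
    rintro rfl
    simp at hne
  · rintro ⟨a, ⟨h1, h2⟩, rfl⟩
    exact ⟨Equiv.Perm.pow_apply_ne_self h1 h2, Equiv.Perm.pow_apply_mem_cycleFinset _ _ _⟩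

omit [NeZero m] in
theorem sum_erase_eq {M : Type*} [AddCommMonoid M] (x : GroupGm1n m n) {c : Finset (Fin n)}
    (hc : c ∈ x.cycles) {i : Fin n} (hi : i ∈ c) (f : Fin n → M) :
    ∑ j ∈ Finset.univ.erase i, f j =
      ∑ j ∈ c.erase i, f j + ∑ c' ∈ x.cycles.erase c, ∑ j ∈ c', f j := by
  classical
  have h := sum_eq_sum_cycles x fun j => if j = i then 0 else f j
  rw [← Finset.add_sum_erase _ _ hc] at h
  have h0 : ∀ s : Finset (Fin n), ∑ j ∈ s.erase i, f j = ∑ j ∈ s, if j = i then 0 else f j := by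
    intro s
    rw [← Finset.filter_ne', Finset.sum_filter]
    exact Finset.sum_congr rfl fun j _ => by split_ifs <;> simp_all
  rw [h0, h0, h]
  congr 1
  refine Finset.sum_congr rfl fun c' hc' => Finset.sum_congr rfl fun j hj => if_neg ?_
  rintro rfl
  rw [Finset.mem_erase] at hc'
  exact (notMem_iff_ne hc hi hc'.2).2 hc'.1 hj

theorem sum_cycleMonomial_r_mul (x : GroupGm1n m n) :
    ∑ t ∈ reflectionClass m n 0, (t * x).cycleMonomial = cutJoinFormulaZero x.cycleMonomial := by
  rw [cycleMonomial, cutJoinFormulaZero_prod_X, ← Finset.sum_add_distrib]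
  have h2 := two_nsmul_sum_reflectionClass fun t => (t * x).cycleMonomial
  rw [← Nat.cast_smul_eq_nsmul ℂ] at h2
  have h3 : ∀ A B : PowerSumRing m, ((2 : ℕ) : ℂ) • A = B → A = (1 / 2 : ℂ) • B := by
    rintro A _ rfl
    rw [smul_smul]
    norm_num
  refine h3 _ _ (h2.trans ?_)
  rw [sum_eq_sum_cycles x]
  refine Finset.sum_congr rfl fun c hc => ?_
  have hcard : ∀ d ∈ x.cycles, ((x.cycleIndex d).2 : ℕ) = d.card := fun d hd => by
    simp [cycleIndex, card_pos_of_mem_cycles hd]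
  have hi : ∀ i ∈ c, ∑ j ∈ Finset.univ.erase i, ∑ α, (r i j α * x).cycleMonomial =
      ∑ a ∈ Finset.Ico 1 c.card, ∑ β : ZMod m,
        (X (β, a.toPNat') * X ((x.cycleIndex c).1 - β, (c.card - a).toPNat') *
          ∏ d ∈ x.cycles.erase c, X (x.cycleIndex d)) +
      ∑ c' ∈ x.cycles.erase c, (m * c'.card) •
        (X ((x.cycleIndex c).1 + (x.cycleIndex c').1, (x.cycleIndex c).2 + (x.cycleIndex c').2) *
          ∏ d ∈ (x.cycles.erase c).erase c', X (x.cycleIndex d)) := by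
    intro i hi
    rw [sum_erase_eq x hc hi]
    congr 1
    · have hci := cycleFinset_eq_of_mem_cycles hc hi
      subst hci
      rw [sum_erase_cycle]
      refine Finset.sum_congr rfl fun a ha => ?_
      rw [Finset.mem_Ico] at ha
      refine Eq.trans ?_ (Equiv.sum_comp (Equiv.subLeft (x.colorSum (x.perm.arc i a))) _)
      exact Finset.sum_congr rfl fun α _ => cycleMonomial_r_mul_cut ha.1 ha.2 α
    · refine Finset.sum_congr rfl fun c' hc' => ?_
      rw [Finset.mem_erase] at hc'
      rw [Finset.sum_congr rfl fun j hj => Finset.sum_congr rfl fun α _ =>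
        cycleMonomial_r_mul_join hc hc'.2 hc'.1 hi hj α]
      simp only [Finset.sum_const, Finset.card_univ, ZMod.card, smul_smul]
      rw [mul_comm]
  rw [Finset.sum_congr rfl hi, Finset.sum_const, smul_add, hcard c hc]
  congr 1
  · simp only [Finset.smul_sum, Nat.cast_smul_eq_nsmul]
  · rw [Finset.smul_sum]
    refine Finset.sum_congr rfl fun c' hc' => ?_
    rw [hcard c' (Finset.mem_of_mem_erase hc'), smul_smul, Nat.cast_smul_eq_nsmul]
    congr 1
    ring

end Reflections

end GroupGm1n

section Theta

variable (m n : ℕ) [NeZero m]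

omit [NeZero m] in
/-- The linear map from the group algebra to `ℂ[p]` sending each group element to its cycle
monomial. -/
noncomputable def cycleMonomialMap : MonoidAlgebra ℂ (GroupGm1n m n) →ₗ[ℂ] PowerSumRing m :=
  Finsupp.linearCombination ℂ GroupGm1n.cycleMonomial ∘ₗ
    (MonoidAlgebra.coeffLinearEquiv ℂ).toLinearMap

variable {m n}

omit [NeZero m] in
theorem cycleMonomialMap_of (x : GroupGm1n m n) :
    cycleMonomialMap m n (MonoidAlgebra.of ℂ _ x) = x.cycleMonomial := by
  show Finsupp.linearCombination ℂ GroupGm1n.cycleMonomial (Finsupp.single x (1 : ℂ)) = _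
  simp

theorem cycleMonomialMap_eq_sum (z : MonoidAlgebra ℂ (GroupGm1n m n)) :
    cycleMonomialMap m n z = ∑ x, z.coeff x • powerSumMonomial x.coloredType := by
  show Finsupp.linearCombination ℂ GroupGm1n.cycleMonomial z.coeff = _
  rw [Finsupp.linearCombination_apply, Finsupp.sum_fintype _ _ fun x => by rw [zero_smul]]
  exact Finset.sum_congr rfl fun x _ => by
    rw [GroupGm1n.powerSumMonomial_coloredType]
    rfl

theorem cycleMonomialMap_mem (z : MonoidAlgebra ℂ (GroupGm1n m n)) :
    cycleMonomialMap m n z ∈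
      weightedHomogeneousSubmodule ℂ (fun v : ZMod m × ℕ+ => (v.2 : ℕ)) n := by
  rw [cycleMonomialMap_eq_sum]
  refine Submodule.sum_mem _ fun x _ => Submodule.smul_mem _ _ ?_
  have h := ColoredPartition.powerSumMonomial_mem x.coloredType
  rwa [GroupGm1n.size_coloredType] at h

omit [NeZero m] in
/-- If a linear operator describes the multiplication by the elements of a finite set on cycle
monomials, then it describes it on the whole group algebra. -/
theorem cycleMonomialMap_sum_mul {S : Finset (GroupGm1n m n)}
    {D : PowerSumRing m →ₗ[ℂ] PowerSumRing m}
    (h : ∀ x, ∑ t ∈ S, (t * x).cycleMonomial = D x.cycleMonomial)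
    (z : MonoidAlgebra ℂ (GroupGm1n m n)) :
    cycleMonomialMap m n ((∑ t ∈ S, MonoidAlgebra.of ℂ _ t) * z) =
      D (cycleMonomialMap m n z) := by
  induction z using MonoidAlgebra.induction_on with
  | of x =>
    rw [cycleMonomialMap_of, ← h, Finset.sum_mul, map_sum]
    exact Finset.sum_congr rfl fun t _ => by rw [← map_mul, cycleMonomialMap_of]
  | add f g hf hg => rw [mul_add, map_add, map_add, map_add, hf, hg]
  | smul c f hf => rw [mul_smul_comm, map_smul, map_smul, map_smul, hf]

omit [NeZero m] in
theorem coeff_conj_of_mem_center {z : MonoidAlgebra ℂ (GroupGm1n m n)}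
    (hz : z ∈ Subalgebra.center ℂ (MonoidAlgebra ℂ (GroupGm1n m n))) (y x : GroupGm1n m n) :
    z.coeff (y * x * y⁻¹) = z.coeff x := by
  have h := congrArg (fun w => w.coeff (y * x))
    (Subalgebra.mem_center_iff.1 hz (MonoidAlgebra.single y 1))
  simpa using h.symm

theorem cycleMonomialMap_injOn_center :
    Function.Injective (cycleMonomialMap m n ∘ₗ (Subalgebra.center ℂ
      (MonoidAlgebra ℂ (GroupGm1n m n))).val.toLinearMap) := by
  classical
  rw [← LinearMap.ker_eq_bot, LinearMap.ker_eq_bot']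
  rintro ⟨z, hz⟩ h
  replace h : cycleMonomialMap m n z = 0 := h
  have hconst : ∀ x x' : GroupGm1n m n, x'.coloredType = x.coloredType →
      z.coeff x' = z.coeff x := by
    intro x x' hxx
    obtain ⟨y, rfl⟩ := GroupGm1n.isConj_of_coloredType_eq hxx.symm
    exact coeff_conj_of_mem_center hz y x
  rw [cycleMonomialMap_eq_sum, ← Finset.sum_fiberwise_of_maps_to
    (t := Finset.univ.image fun x : GroupGm1n m n => x.coloredType)
    fun x _ => Finset.mem_image_of_mem _ (Finset.mem_univ x)] at h
  have h' : ∑ lam ∈ Finset.univ.image fun x : GroupGm1n m n => x.coloredType,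
      (∑ x : GroupGm1n m n with x.coloredType = lam, z.coeff x) • powerSumMonomial lam = 0 := by
    rw [← h]
    refine Finset.sum_congr rfl fun lam _ => ?_
    rw [Finset.sum_smul]
    exact Finset.sum_congr rfl fun x hx => by rw [(Finset.mem_filter.1 hx).2]
  have h0 := linearIndependent_iff'.1 ColoredPartition.linearIndependent_powerSumMonomial _ _ h'
  apply Subtype.ext
  refine MonoidAlgebra.ext (Finsupp.ext fun x => ?_)
  have hx := h0 _ (Finset.mem_image_of_mem _ (Finset.mem_univ x))
  rw [Finset.sum_congr rfl fun x' hx' => hconst x x' (Finset.mem_filter.1 hx').2,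
    Finset.sum_const, smul_eq_zero, Finset.card_eq_zero] at hx
  exact hx.resolve_left (Finset.ne_empty_of_mem
    (Finset.mem_filter.2 ⟨Finset.mem_univ x, rfl⟩))

theorem cycleMonomialMap_classAverage {lam : ColoredPartition m} (h : lam.size = n) :
    cycleMonomialMap m n (classAverage n lam) = powerSumMonomial lam := by
  obtain ⟨x, hx⟩ := GroupGm1n.exists_coloredType_eq lam h
  have hcard : ((GroupGm1n.conjClass n lam).card : ℂ) ≠ 0 := by
    rw [Nat.cast_ne_zero, Finset.card_ne_zero]
    exact ⟨x, by simp [GroupGm1n.conjClass, hx]⟩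
  show cycleMonomialMap m n (((GroupGm1n.conjClass n lam).card : ℂ)⁻¹ •
    ∑ x ∈ GroupGm1n.conjClass n lam, MonoidAlgebra.of ℂ (GroupGm1n m n) x) = _
  rw [map_smul, map_sum, Finset.sum_congr rfl fun y hy => show _ = powerSumMonomial lam from ?_,
    Finset.sum_const, ← Nat.cast_smul_eq_nsmul ℂ, smul_smul, inv_mul_cancel₀ hcard, one_smul]
  rw [GroupGm1n.conjClass, Finset.mem_filter] at hy
  rw [cycleMonomialMap_of, GroupGm1n.cycleMonomial, ← GroupGm1n.powerSumMonomial_coloredType, hy.2]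

/-- Two linear maps on the center that both send every `𝓒_λ` to `p_λ` take any prescribed value in
the homogeneous component at a common point. -/
theorem exists_common_preimage {A B : GroupCenter m n →ₗ[ℂ] PowerSumRing m}
    (hA : ∀ lam : ColoredPartition m, lam.size = n →
      A (classAverage n lam) = powerSumMonomial lam)
    (hB : ∀ lam : ColoredPartition m, lam.size = n →
      B (classAverage n lam) = powerSumMonomial lam)
    {f : PowerSumRing m}
    (hf : f ∈ weightedHomogeneousSubmodule ℂ (fun v : ZMod m × ℕ+ => (v.2 : ℕ)) n) :
    ∃ z, A z = f ∧ B z = f := by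
  replace hf := ColoredPartition.mem_span_powerSumMonomial hf
  induction hf using Submodule.span_induction with
  | mem f h =>
    obtain ⟨lam, hlam, rfl⟩ := h
    exact ⟨classAverage n lam, hA lam hlam, hB lam hlam⟩
  | zero => exact ⟨0, map_zero _, map_zero _⟩
  | add f g _ _ hf hg =>
    obtain ⟨z, h1, h2⟩ := hf
    obtain ⟨w, h3, h4⟩ := hg
    exact ⟨z + w, by rw [map_add, h1, h3], by rw [map_add, h2, h4]⟩
  | smul a f _ hf =>
    obtain ⟨z, h1, h2⟩ := hf
    exact ⟨a • z, by rw [map_smul, h1], by rw [map_smul, h2]⟩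

theorem exists_isTheta (m n : ℕ) [NeZero m] :
    ∃ Θ : GroupCenter m n ≃ₗ[ℂ] PowerSumComponent m n, IsTheta Θ := by
  let A : GroupCenter m n →ₗ[ℂ] PowerSumRing m := cycleMonomialMap m n ∘ₗ
    (Subalgebra.center ℂ (MonoidAlgebra ℂ (GroupGm1n m n))).val.toLinearMap
  have hA : ∀ lam : ColoredPartition m, lam.size = n →
      A (classAverage n lam) = powerSumMonomial lam := fun lam => cycleMonomialMap_classAverage
  refine ⟨LinearEquiv.ofBijective (A.codRestrict _ fun z => cycleMonomialMap_mem z.1)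
    ⟨fun z w h => cycleMonomialMap_injOn_center (congrArg Subtype.val h), fun f => ?_⟩, hA⟩
  obtain ⟨z, hz, -⟩ := exists_common_preimage hA hA f.2
  exact ⟨z, Subtype.ext hz⟩

theorem IsTheta.apply_eq {Θ : GroupCenter m n ≃ₗ[ℂ] PowerSumComponent m n} (hΘ : IsTheta Θ)
    (z : GroupCenter m n) : (Θ z : PowerSumRing m) = cycleMonomialMap m n z := by
  obtain ⟨w, h1, h2⟩ := exists_common_preimage (A := Submodule.subtype _ ∘ₗ Θ.toLinearMap)
    (B := cycleMonomialMap m n ∘ₗ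
      (Subalgebra.center ℂ (MonoidAlgebra ℂ (GroupGm1n m n))).val.toLinearMap)
    hΘ (fun lam => cycleMonomialMap_classAverage) (cycleMonomialMap_mem z.1)
  obtain rfl : w = z := cycleMonomialMap_injOn_center h2
  exact h1

theorem IsTheta.cutJoin_apply {Θ : GroupCenter m n ≃ₗ[ℂ] PowerSumComponent m n}
    (hΘ : IsTheta Θ) {k : ZMod m} {D : PowerSumRing m →ₗ[ℂ] PowerSumRing m}
    (h : ∀ x : GroupGm1n m n, ∑ t ∈ GroupGm1n.reflectionClass m n k, (t * x).cycleMonomial =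
      D x.cycleMonomial) (f : PowerSumComponent m n) :
    (cutJoin Θ k f : PowerSumRing m) = D f := by
  obtain ⟨z, rfl⟩ := Θ.surjective f
  rw [cutJoin, LinearEquiv.conj_apply_apply, Θ.symm_apply_apply, hΘ.apply_eq, hΘ.apply_eq]
  exact cycleMonomialMap_sum_mul h z.1

end Theta

theorem mainTheorem1 (m n : ℕ) [NeZero m] :
    (∃! Θ : GroupCenter m n ≃ₗ[ℂ] PowerSumComponent m n, IsTheta Θ) ∧
    ∀ Θ : GroupCenter m n ≃ₗ[ℂ] PowerSumComponent m n, IsTheta Θ →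
      (∀ f : PowerSumComponent m n,
        (cutJoin Θ 0 f : PowerSumRing m) = cutJoinFormulaZero (f : PowerSumRing m)) ∧
      (∀ k : ZMod m, k ≠ 0 → ∀ f : PowerSumComponent m n,
        (cutJoin Θ k f : PowerSumRing m) = cutJoinFormula k (f : PowerSumRing m)) := by
  refine ⟨?_, fun Θ hΘ => ⟨?_, fun k hk => ?_⟩⟩
  · obtain ⟨Θ, hΘ⟩ := exists_isTheta m n
    refine ⟨Θ, hΘ, fun Θ' hΘ' => LinearEquiv.ext fun z => Subtype.ext ?_⟩
    rw [hΘ.apply_eq, hΘ'.apply_eq]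
  · exact hΘ.cutJoin_apply (D := cutJoinLinearZero) GroupGm1n.sum_cycleMonomial_r_mul
  · exact hΘ.cutJoin_apply (D := cutJoinLinear k) (GroupGm1n.sum_cycleMonomial_l_mul hk)
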